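/- Let $C_1,\dots,C_m\in\mathbb C^{3\times 4}$ be matrices of rank $3$ (cameras) whose centers $\ker C_i$, viewed as points of $\mathbb P^3$, are pairwise distinct; for each $i$ let $c_i\in\mathbb C^4$ be a vector spanning $\ker C_i$. The *line multiview variety* $\mathcal L_{\mathcal C}\subseteq(\mathbb P^2)^m$ is the Zariski closure of the set of all tuples $(\ell_1,\dots,\ell_m)$ with $\ell_i=(C_ia)\times(C_ib)$, where $a,b\in\mathbb C^4$ span a line in $\mathbb P^3$ that contains none of the centers. Let $R=\mathbb C[\ell_{k,i}\mid 1\le k\le 3,\ 1\le i\le m]$, $\ell_i=(\ell_{1,i},\ell_{2,i},\ell_{3,i})^T$, $h_i=C_i^T\ell_i\in R^4$, and let $M(\ell)=[\,h_1\ \cdots\ h_m\,]\in R^{4\times m}$. Let $\mathcal J$ be the collection of four-element sets $\sigma=\{i_1<i_2<i_3<i_4\}\subseteq\{1,\dots,m\}$ such that the centers of the cameras $C_i$, $i\in\sigma$, lie on a common line $E_\sigma\subset\mathbb P^3$. For each $\sigma\in\mathcal J$ choose any line $E_\sigma^*\subset\mathbb P^3$ disjoint from $E_\sigma$ and vectors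 $f_1,f_2,f_3\in\mathbb C^4$ (depending on $\sigma$) representing three distinct points of $E_\sigma^*$; put $e_i(\ell_i)=c_i-(h_i^Tf_2)f_1+(h_i^Tf_1)f_2$ for $i\in\sigma$, and let $\Phi_{\mathcal C,f,\sigma}(\ell)\in R^{10\times10}$ be the matrix with columns $$\nu(c_{i_1}),\ \nu(c_{i_2}),\ \nu(c_{i_3}),\ \nu(f_1),\ \nu(f_2),\ \nu(f_3),\ \nu(e_{i_1}(\ell_{i_1})),\ \nu(e_{i_2}(\ell_{i_2})),\ \nu(e_{i_3}(\ell_{i_3})),\ \nu(e_{i_4}(\ell_{i_4})),$$ where $\nu(x,y,z,w)=(x^2,y^2,z^2,w^2,xy,xz,xw,yz,yw,zw)^T$. Define the ideal $$\widetilde I_{\mathcal C}=\langle 3\times3\text{ minors of }M(\ell)\rangle+\sum_{\sigma\in\mathcal J}\langle\det\Phi_{\mathcal C,f,\sigma}(\ell)\rangle\subseteq R.$$ Then, for every such choice of the $c_i$, the lines $E_\sigma^*$ and the points $f$, the line multiview variety is cut out set-theoretically by $\widetilde I_{\mathcal C}$: $$\mathcal L_{\mathcal C}=\{\ell\in(\mathbb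 P^2)^m\mid F(\ell)=0\text{ for all }F\in\widetilde I_{\mathcal C}\}.$$ -/

import Mathlib

open scoped Matrix LinearAlgebra.Projectivization

noncomputable section

namespace LineMultiview

/-- The complex vector space whose projectivization is `ℙ³`. -/
abbrev V4 : Type := Fin 4 → ℂ

/-- The (dual) projective plane. -/
abbrev P2 : Type := ℙ ℂ (Fin 3 → ℂ)

/-- The polynomial ring `R = ℂ[ℓ_{k,i}]`; the variable `(i, k)` is the `k`-th coordinate
of the `i`-th image line. -/
abbrev R (m : ℕ) : Type := MvPolynomial (Fin m × Fin 3) ℂ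

/-! ### The Zariski topology of `(ℙ²)^m` -/

/-- `F` is homogeneous of some degree `d i` in each group `(ℓ_{1,i}, ℓ_{2,i}, ℓ_{3,i})` of
variables. -/
def IsMultihomogeneous {m : ℕ} (F : R m) : Prop :=
  ∃ d : Fin m → ℕ,
    MvPolynomial.IsWeightedHomogeneous (fun p : Fin m × Fin 3 => (Pi.single p.1 1 : Fin m → ℕ)) F d

/-- `F` vanishes at `ℓ ∈ (ℙ²)^m`: it vanishes at all tuples of homogeneous coordinates of `ℓ`
(for multihomogeneous `F` it is the same to ask this of one tuple). -/
def VanishesAt {m : ℕ} (F : R m) (l : Fin m → P2) : Prop :=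
  ∀ (v : Fin m → Fin 3 → ℂ) (hv : ∀ i, v i ≠ 0),
    (∀ i, Projectivization.mk ℂ (v i) (hv i) = l i) →
      MvPolynomial.eval (fun p : Fin m × Fin 3 => v p.1 p.2) F = 0

/-- The common zero locus in `(ℙ²)^m` of a set of polynomials. -/
def zeroLocus {m : ℕ} (S : Set (R m)) : Set (Fin m → P2) :=
  {l | ∀ F ∈ S, VanishesAt F l}

/-- Zariski closed subsets of `(ℙ²)^m`. -/
def IsZariskiClosed {m : ℕ} (Z : Set (Fin m → P2)) : Prop :=
  ∃ S : Set (R m), (∀ F ∈ S, IsMultihomogeneous F) ∧ Z = zeroLocus S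

/-- The smallest Zariski closed set containing `X`. -/
def zariskiClosure {m : ℕ} (X : Set (Fin m → P2)) : Set (Fin m → P2) :=
  ⋂₀ {Z | IsZariskiClosed Z ∧ X ⊆ Z}

/-! ### Cameras and the line multiview variety -/

/-- The center of a camera matrix: its kernel, a one-dimensional subspace of `ℂ⁴` (that is, a point
of `ℙ³`) when the matrix has rank 3. -/
def center (A : Matrix (Fin 3) (Fin 4) ℂ) : Submodule ℂ V4 :=
  LinearMap.ker A.mulVecLin

/-- The image of the joint camera map `Υ_C` on the Grassmannian of lines in `ℙ³`, i.e. of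
two-dimensional subspaces `L` of `ℂ⁴`. It sends the line spanned by `a` and `b` to the tuple of the
`(C_i a) × (C_i b)`, and is defined where none of these is zero (i.e. where `L` passes through no
camera center). -/
def jointImage {m : ℕ} (C : Fin m → Matrix (Fin 3) (Fin 4) ℂ) : Set (Fin m → P2) :=
  {l | ∃ L : Submodule ℂ V4, Module.finrank ℂ L = 2 ∧
    ∃ a b : V4, Submodule.span ℂ {a, b} = L ∧
      ∀ i, ∃ h : (C i *ᵥ a) ⨯₃ (C i *ᵥ b) ≠ 0,
        l i = Projectivization.mk ℂ ((C i *ᵥ a) ⨯₃ (C i *ᵥ b)) h}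

/-- The line multiview variety. -/
def lineMultiviewVariety {m : ℕ} (C : Fin m → Matrix (Fin 3) (Fin 4) ℂ) : Set (Fin m → P2) :=
  zariskiClosure (jointImage C)

/-! ### The matrix `M(ℓ)` and its minors -/

/-- The polynomial vector `h_i = C_iᵀ ℓ_i`. -/
def backPlane {m : ℕ} (C : Fin m → Matrix (Fin 3) (Fin 4) ℂ) (i : Fin m) : Fin 4 → R m :=
  ((C i).map MvPolynomial.C)ᵀ *ᵥ fun k => MvPolynomial.X (i, k)

/-- The `4 × m` matrix `M(ℓ)` with columns `C_iᵀ ℓ_i`. -/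
def M {m : ℕ} (C : Fin m → Matrix (Fin 3) (Fin 4) ℂ) : Matrix (Fin 4) (Fin m) (R m) :=
  Matrix.of fun j i => backPlane C i j

/-- The `3 × 3` minors of `M(ℓ)`. -/
def minors {m : ℕ} (C : Fin m → Matrix (Fin 3) (Fin 4) ℂ) : Set (R m) :=
  {d | ∃ (r : Fin 3 ↪o Fin 4) (s : Fin 3 ↪o Fin m), d = ((M C).submatrix r s).det}

/-! ### Collinear quadruples and the matrix `Φ`

A four-element index set `σ ⊆ {1, …, m}` is given by its increasing enumeration
`σ : Fin 4 ↪o Fin m`. -/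

/-- The span `E_σ` of the centers with index in `σ`. -/
def baseline {m : ℕ} (C : Fin m → Matrix (Fin 3) (Fin 4) ℂ) (σ : Fin 4 ↪o Fin m) :
    Submodule ℂ V4 :=
  ⨆ k, center (C (σ k))

/-- The four centers with index in `σ` lie on a common projective line. -/
def IsCollinear {m : ℕ} (C : Fin m → Matrix (Fin 3) (Fin 4) ℂ) (σ : Fin 4 ↪o Fin m) : Prop :=
  ∃ E : Submodule ℂ V4, Module.finrank ℂ E = 2 ∧ ∀ k, center (C (σ k)) ≤ E

/-- `c` is a vector of homogeneous coordinates of the center of `A`. -/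
def IsCenterVector (A : Matrix (Fin 3) (Fin 4) ℂ) (c : V4) : Prop :=
  c ≠ 0 ∧ Submodule.span ℂ {c} = center A

/-- `f₁, f₂, f₃` are (homogeneous coordinates of) three distinct points on some projective line
`E_σ*` that is disjoint from the line `E`. -/
def IsDualTriple (E : Submodule ℂ V4) (f : Fin 3 → V4) : Prop :=
  ∃ Estar : Submodule ℂ V4, Module.finrank ℂ Estar = 2 ∧ Disjoint Estar E ∧
    (∀ k, f k ∈ Estar) ∧ ∀ k l, k ≠ l → LinearIndependent ℂ ![f k, f l]

/-- The affine Veronese map `ν : S⁴ → S¹⁰`. -/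
def veronese {S : Type*} [CommRing S] (p : Fin 4 → S) : Fin 10 → S :=
  ![p 0 ^ 2, p 1 ^ 2, p 2 ^ 2, p 3 ^ 2, p 0 * p 1, p 0 * p 2, p 0 * p 3, p 1 * p 2, p 1 * p 3,
    p 2 * p 3]

/-- A vector of `ℂ⁴` as a vector of constant polynomials. -/
def const (m : ℕ) (x : V4) : Fin 4 → R m := fun j => MvPolynomial.C (x j)

/-- `e_i(ℓ_i) = c_i - (h_iᵀ f₂) f₁ + (h_iᵀ f₁) f₂`. -/
def e {m : ℕ} (C : Fin m → Matrix (Fin 3) (Fin 4) ℂ) (c : Fin m → V4) (f : Fin 3 → V4)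
    (i : Fin m) : Fin 4 → R m :=
  const m (c i) - (backPlane C i ⬝ᵥ const m (f 1)) • const m (f 0)
    + (backPlane C i ⬝ᵥ const m (f 0)) • const m (f 1)

/-- The `10 × 10` matrix `Φ_{C,f,σ}(ℓ)`, whose columns are the images under the Veronese map of
`c₁, c₂, c₃, f₁, f₂, f₃, e₁(ℓ₁), e₂(ℓ₂), e₃(ℓ₃), e₄(ℓ₄)`. -/
def Phi {m : ℕ} (C : Fin m → Matrix (Fin 3) (Fin 4) ℂ) (c : Fin m → V4) (f : Fin 3 → V4)
    (σ : Fin 4 ↪o Fin m) : Matrix (Fin 10) (Fin 10) (R m) :=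
  (Matrix.of
    ![veronese (const m (c (σ 0))), veronese (const m (c (σ 1))), veronese (const m (c (σ 2))),
      veronese (const m (f 0)), veronese (const m (f 1)), veronese (const m (f 2)),
      veronese (e C c f (σ 0)), veronese (e C c f (σ 1)), veronese (e C c f (σ 2)),
      veronese (e C c f (σ 3))])ᵀ

/-- The ideal `Ĩ_C` generated by the `3 × 3` minors of `M(ℓ)` and by `det Φ_{C,f,σ}(ℓ)` for all
sets `σ` of four collinear cameras. -/
def extendedIdeal {m : ℕ} (C : Fin m → Matrix (Fin 3) (Fin 4) ℂ) (c : Fin m → V4)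
    (f : (Fin 4 ↪o Fin m) → Fin 3 → V4) : Ideal (R m) :=
  Ideal.span (minors C) ⊔
    ⨆ (σ : Fin 4 ↪o Fin m) (_ : IsCollinear C σ), Ideal.span {(Phi C c (f σ) σ).det}

end LineMultiview

end

/-!
Write `h_i = C_iᵀ ℓ_i`, a plane through the center `c_i`. The minors of `M(ℓ)` vanish exactly when
the planes `h_i` have a line `L = ⟨p, q⟩` in common (`forall_minors_iff`).

**The extra equations.** Let four centers lie on a line `E`, skew to the dual line `E*`. The matrix
`Φ` is singular exactly when a quadric passes through its ten points. Such a quadric meets `E` and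
`E*` in three given points each, so contains both lines, and what remains of it is a bilinear form
on `E × E*` that pairs the center `c_i` with the point `h_i ∩ E*` to zero. Hence `det Φ` and the
determinant of the `4 × 4` matrix of the tensors `c_i ⊗ (h_i ∩ E*)` have the same zeros
(`exists_det_Phi_eq_zero_iff`). The latter is multihomogeneous, so the zero locus of the ideal is
closed; and it vanishes on the image of the camera map, because any line `⟨p, q⟩` yields such a
bilinear form, namely `(u, f) ↦ det(f, u, p, q)` (`det_tensorMatrix_eq_zero`). This gives one
inclusion.

**The zero locus lies in the closure.** Let `ℓ` satisfy the equations and let `L` be a line in all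
planes `h_i`. Centers off `L` cause no problem. A center on `L` is moved off `L` by a
deformation `A : L → ℂ⁴ / L` of the line, and in the limit its plane is spanned by `L` and `A c_i`;
so `A` has to satisfy `h_i (A c_i) = 0`, one linear equation in the four-dimensional space of such
maps for each center on `L`. The extra equations say that any four of these are dependent, so a
nonzero `A` exists (`exists_first_order`). If `A` kills a center, it kills only one of them, and a
second-order term moves that one in the required direction (`exists_deformation`). Every polynomial
that vanishes on the image of the camera map vanishes along the resulting polynomial curve for
all but finitely many parameters, hence at its limit `ℓ` (`evalAt_eq_zero_of_isLimit`).
-/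

open scoped Matrix LinearAlgebra.Projectivization

noncomputable section

namespace LineMultiview

/-! ### Linear algebra -/

/-- A family of vectors spanning a space of dimension at least `k` has `k` linearly independent
members, listed with increasing indices. -/
theorem exists_orderEmb_linearIndependent {ι V : Type*} [LinearOrder ι] [Fintype ι] [AddCommGroup V]
    [Module ℂ V] (x : ι → V) {k : ℕ}
    (hk : k ≤ Module.finrank ℂ (Submodule.span ℂ (Set.range x))) :
    ∃ s : Fin k ↪o ι, LinearIndependent ℂ (x ∘ s) := by
  obtain ⟨t, a, hinj, hspan, hli⟩ := exists_linearIndependent' ℂ x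
  have : Fintype t := @Fintype.ofFinite _ (Finite.of_injective a hinj)
  have hcard : Module.finrank ℂ (Submodule.span ℂ (Set.range x)) = Fintype.card t := by
    rw [← hspan, finrank_span_eq_card hli]
  have hle : k ≤ (Finset.univ.map ⟨a, hinj⟩).card := by
    rw [Finset.card_map, Finset.card_univ, ← hcard]; exact hk
  obtain ⟨u, hu, huc⟩ := Finset.exists_subset_card_eq hle
  refine ⟨u.orderEmbOfFin huc, ?_⟩
  have hmem : ∀ j, ∃ y : t, a y = u.orderEmbOfFin huc j := fun j => by
    have := hu (u.orderEmbOfFin_mem huc j)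
    simpa using this
  choose g hg using hmem
  have hgi : Function.Injective g := fun i j hij => by
    apply (u.orderEmbOfFin huc).injective
    rw [← hg, ← hg, hij]
  have heq : x ∘ u.orderEmbOfFin huc = (x ∘ a) ∘ g := by
    funext j
    simp [hg]
  rw [heq]
  exact hli.comp g hgi

/-- A family of vectors any `n` of which (with increasing indices) are dependent in `ℂⁿ` has a
nonzero common annihilator. -/
theorem exists_annihilator {ι : Type*} [LinearOrder ι] [Fintype ι] {n : ℕ} (x : ι → Fin n → ℂ)
    (h : ∀ s : Fin n ↪o ι, ¬ LinearIndependent ℂ (x ∘ s)) :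
    ∃ α : Fin n → ℂ, α ≠ 0 ∧ ∀ i, x i ⬝ᵥ α = 0 := by
  have hlt : Submodule.span ℂ (Set.range x) < ⊤ := by
    rw [lt_top_iff_ne_top]
    intro htop
    obtain ⟨s, hs⟩ := exists_orderEmb_linearIndependent x (k := n) (by rw [htop]; simp)
    exact h s hs
  obtain ⟨φ, hφ, hle⟩ := Submodule.exists_le_ker_of_lt_top _ hlt
  have hφ' : ∀ y, φ y = y ⬝ᵥ fun j => φ (Pi.single j 1) := fun y => by
    conv_lhs => rw [← Finset.univ_sum_single y]
    simp only [map_sum, dotProduct]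
    refine Finset.sum_congr rfl fun j _ => ?_
    rw [← mul_one (y j), ← smul_eq_mul (y j) 1, Pi.single_smul, map_smul]; simp
  refine ⟨fun j => φ (Pi.single j 1), fun h0 => hφ ?_, fun i => ?_⟩
  · ext y
    simpa using congrFun h0 y
  · rw [← hφ']
    exact hle (Submodule.subset_span ⟨i, rfl⟩)

/-- Two independent vectors of a two-dimensional space span it. -/
theorem exists_eq_smul_add_smul {E : Submodule ℂ V4} (hE : Module.finrank ℂ E = 2) {x y z : V4}
    (hx : x ∈ E) (hy : y ∈ E) (hxy : LinearIndependent ℂ ![x, y]) (hz : z ∈ E) :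
    ∃ a b : ℂ, z = a • x + b • y := by
  have hle : Submodule.span ℂ {x, y} ≤ E := by
    rw [Submodule.span_le]; rintro _ (rfl | rfl) <;> assumption
  have h2 := finrank_span_eq_card hxy
  rw [Matrix.range_cons_cons_empty, Fintype.card_fin] at h2
  have := Submodule.eq_of_le_of_finrank_eq hle (by rw [h2, hE])
  rw [← this, Submodule.mem_span_pair] at hz
  obtain ⟨a, b, h⟩ := hz
  exact ⟨a, b, h.symm⟩

/-- Two independent vectors of `ℂ⁴` are the first half of a basis. -/
theorem exists_basis_extension {p q : V4} (h : LinearIndependent ℂ ![p, q]) :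
    ∃ g₁ g₂ : V4, LinearIndependent ℂ ![g₁, g₂, p, q] := by
  obtain ⟨g₂, h₂⟩ := exists_linearIndependent_cons_of_lt_finrank (R := ℂ) h
    (by rw [Module.finrank_fin_fun]; norm_num)
  obtain ⟨g₁, h₁⟩ := exists_linearIndependent_cons_of_lt_finrank (R := ℂ) h₂
    (by rw [Module.finrank_fin_fun]; norm_num)
  exact ⟨g₁, g₂, h₁⟩

/-- Coordinates with respect to four independent vectors of `ℂ⁴`. -/
theorem exists_coords {w : Fin 4 → V4} (hw : LinearIndependent ℂ w) (z : V4) :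
    ∃ s : Fin 4 → ℂ, z = s 0 • w 0 + s 1 • w 1 + s 2 • w 2 + s 3 • w 3 := by
  have := hw.span_eq_top_of_card_eq_finrank (by simp)
  have hz : z ∈ Submodule.span ℂ (Set.range w) := this ▸ Submodule.mem_top
  obtain ⟨s, hs⟩ := (Submodule.mem_span_range_iff_exists_fun ℂ).1 hz
  exact ⟨s, by rw [← hs, Fin.sum_univ_four]⟩

/-- In `ℂ³` a nonzero vector orthogonal to two independent vectors is a multiple of their cross
product. -/
theorem exists_cross_eq_smul {x y v : Fin 3 → ℂ} (hxy : x ⨯₃ y ≠ 0) (hv : v ≠ 0)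
    (hx : v ⬝ᵥ x = 0) (hy : v ⬝ᵥ y = 0) : ∃ s : ℂ, s ≠ 0 ∧ x ⨯₃ y = s • v := by
  have h0 : v ⨯₃ (x ⨯₃ y) = 0 := by
    rw [cross_cross_eq_smul_sub_smul' v x y, dotProduct_comm x v, hx, hy]
    simp
  have hdep : ¬ LinearIndependent ℂ ![v, x ⨯₃ y] := fun h =>
    crossProduct_ne_zero_iff_linearIndependent.2 h h0
  rw [LinearIndependent.pair_iff' hv] at hdep
  push Not at hdep
  obtain ⟨s, hs⟩ := hdep
  refine ⟨s, fun h => hxy ?_, hs.symm⟩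
  rw [← hs, h, zero_smul]

/-! ### Cameras -/

theorem IsCenterVector.mulVec_eq_zero {A : Matrix (Fin 3) (Fin 4) ℂ} {c : V4}
    (hc : IsCenterVector A c) : A *ᵥ c = 0 := by
  have : c ∈ center A := hc.2 ▸ Submodule.mem_span_singleton_self c
  simpa [center] using this

theorem IsCenterVector.exists_eq_smul {A : Matrix (Fin 3) (Fin 4) ℂ} {c z : V4}
    (hc : IsCenterVector A c) (hz : A *ᵥ z = 0) : ∃ r : ℂ, z = r • c := by
  have : z ∈ center A := by simpa [center] using hz
  rw [← hc.2, Submodule.mem_span_singleton] at this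
  obtain ⟨r, hr⟩ := this
  exact ⟨r, hr.symm⟩

/-- Two points are mapped by a camera to different image points exactly when they are not collinear
with the center. -/
theorem IsCenterVector.cross_ne_zero {A : Matrix (Fin 3) (Fin 4) ℂ} {c x y : V4}
    (hc : IsCenterVector A c) (h : LinearIndependent ℂ ![c, x, y]) :
    (A *ᵥ x) ⨯₃ (A *ᵥ y) ≠ 0 := by
  rw [crossProduct_ne_zero_iff_linearIndependent, LinearIndependent.pair_iff]
  intro s t hst
  rw [← Matrix.mulVec_smul, ← Matrix.mulVec_smul, ← Matrix.mulVec_add] at hst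
  obtain ⟨r, hr⟩ := hc.exists_eq_smul hst
  have := Fintype.linearIndependent_iff.1 h ![-r, s, t] (by
    simp [Fin.sum_univ_succ]; rw [hr]; simp)
  exact ⟨this 1, this 2⟩

theorem IsCenterVector.linearIndependent {A : Matrix (Fin 3) (Fin 4) ℂ} {c x y : V4}
    (hc : IsCenterVector A c) (h : (A *ᵥ x) ⨯₃ (A *ᵥ y) ≠ 0) :
    LinearIndependent ℂ ![c, x, y] := by
  rw [crossProduct_ne_zero_iff_linearIndependent, LinearIndependent.pair_iff] at h
  rw [Fintype.linearIndependent_iff]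
  intro g hg
  simp only [Fin.sum_univ_three, Fin.isValue, Matrix.cons_val_zero, Matrix.cons_val_one,
    Matrix.cons_val] at hg
  have h1 := congrArg (fun z => A *ᵥ z) hg
  simp only [Matrix.mulVec_add, Matrix.mulVec_smul, hc.mulVec_eq_zero, Matrix.mulVec_zero,
    smul_zero, zero_add] at h1
  obtain ⟨h2, h3⟩ := h _ _ h1
  have h4 : g 0 • c = 0 := by
    simpa [h2, h3] using hg
  have h5 : g 0 = 0 := (smul_eq_zero.1 h4).resolve_right hc.1
  intro i
  fin_cases i
  · exact h5
  · exact h2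
  · exact h3

/-- Distinct centers are independent vectors. -/
theorem linearIndependent_centers {A B : Matrix (Fin 3) (Fin 4) ℂ} {c d : V4}
    (hc : IsCenterVector A c) (hd : IsCenterVector B d) (h : center A ≠ center B) :
    LinearIndependent ℂ ![c, d] := by
  rw [LinearIndependent.pair_iff' hc.1]
  intro r hr
  apply h
  rw [← hc.2, ← hd.2, ← hr]
  have : IsUnit r := by
    rw [isUnit_iff_ne_zero]; rintro rfl
    exact hd.1 (by rw [← hr, zero_smul])
  exact (Submodule.span_singleton_smul_eq this c).symm

/-- The transpose of a camera of full rank is injective. -/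
theorem eq_zero_of_forall_dotProduct_mulVec {A : Matrix (Fin 3) (Fin 4) ℂ} (hA : A.rank = 3)
    {v : Fin 3 → ℂ} (h : ∀ z, v ⬝ᵥ A *ᵥ z = 0) : v = 0 := by
  have htop : LinearMap.range A.mulVecLin = ⊤ := by
    apply Submodule.eq_top_of_finrank_eq
    rw [← Matrix.rank, hA]; simp
  rw [← dotProduct_eq_zero_iff]
  intro w
  obtain ⟨z, rfl⟩ := LinearMap.range_eq_top.1 htop w
  exact h z

/-! ### Quadrics through the ten points -/

/-- The coefficients of the quadratic form `x ↦ xᵀ N x`, in the order of the monomials of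
`veronese`. -/
def quadricCoeff (N : Matrix (Fin 4) (Fin 4) ℂ) : Fin 10 → ℂ :=
  ![N 0 0, N 1 1, N 2 2, N 3 3, N 0 1 + N 1 0, N 0 2 + N 2 0, N 0 3 + N 3 0, N 1 2 + N 2 1,
    N 1 3 + N 3 1, N 2 3 + N 3 2]

/-- The upper triangular matrix of the quadratic form with coefficients `w`. -/
def quadricMatrix (w : Fin 10 → ℂ) : Matrix (Fin 4) (Fin 4) ℂ :=
  !![w 0, w 4, w 5, w 6; 0, w 1, w 7, w 8; 0, 0, w 2, w 9; 0, 0, 0, w 3]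

theorem veronese_dotProduct (x : V4) (w : Fin 10 → ℂ) :
    veronese x ⬝ᵥ w = x 0 ^ 2 * w 0 + x 1 ^ 2 * w 1 + x 2 ^ 2 * w 2 + x 3 ^ 2 * w 3 +
      x 0 * x 1 * w 4 + x 0 * x 2 * w 5 + x 0 * x 3 * w 6 + x 1 * x 2 * w 7 +
      x 1 * x 3 * w 8 + x 2 * x 3 * w 9 := by
  simp only [dotProduct, veronese, Fin.sum_univ_succ]
  simp [Fin.succ]
  ring

theorem veronese_dotProduct_quadricCoeff (N : Matrix (Fin 4) (Fin 4) ℂ) (x : V4) :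
    veronese x ⬝ᵥ quadricCoeff N = x ⬝ᵥ N *ᵥ x := by
  rw [veronese_dotProduct]
  simp [quadricCoeff, dotProduct, Matrix.mulVec, Fin.sum_univ_four]
  ring

theorem veronese_dotProduct_eq_quadricMatrix (w : Fin 10 → ℂ) (x : V4) :
    veronese x ⬝ᵥ w = x ⬝ᵥ quadricMatrix w *ᵥ x := by
  rw [veronese_dotProduct]
  simp [quadricMatrix, dotProduct, Matrix.mulVec, Fin.sum_univ_four]
  ring

theorem eq_zero_of_forall_veronese {w : Fin 10 → ℂ} (h : ∀ x : V4, veronese x ⬝ᵥ w = 0) :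
    w = 0 := by
  have e0 := h ![1, 0, 0, 0]
  have e1 := h ![0, 1, 0, 0]
  have e2 := h ![0, 0, 1, 0]
  have e3 := h ![0, 0, 0, 1]
  have e4 := h ![1, 1, 0, 0]
  have e5 := h ![1, 0, 1, 0]
  have e6 := h ![1, 0, 0, 1]
  have e7 := h ![0, 1, 1, 0]
  have e8 := h ![0, 1, 0, 1]
  have e9 := h ![0, 0, 1, 1]
  simp [veronese_dotProduct] at e0 e1 e2 e3
  simp [veronese_dotProduct, e0, e1, e2, e3] at e4 e5 e6 e7 e8 e9
  funext i
  fin_cases i <;> simpa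

/-- A linear change of coordinates carries quadrics to quadrics. -/
theorem exists_quadric_comp_mulVec (B : Matrix (Fin 4) (Fin 4) ℂ) (hB : IsUnit B)
    {w : Fin 10 → ℂ} (hw : w ≠ 0) :
    ∃ w' : Fin 10 → ℂ, w' ≠ 0 ∧ ∀ s, veronese s ⬝ᵥ w' = veronese (B *ᵥ s) ⬝ᵥ w := by
  have key : ∀ s, veronese s ⬝ᵥ quadricCoeff (Bᵀ * quadricMatrix w * B) =
      veronese (B *ᵥ s) ⬝ᵥ w := fun s => by
    rw [veronese_dotProduct_quadricCoeff, veronese_dotProduct_eq_quadricMatrix,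
      ← Matrix.mulVec_mulVec, ← Matrix.mulVec_mulVec, Matrix.dotProduct_mulVec,
      Matrix.vecMul_transpose]
  refine ⟨_, fun h0 => hw (eq_zero_of_forall_veronese fun x => ?_), key⟩
  have hx : x = B *ᵥ (B⁻¹ *ᵥ x) := by
    rw [Matrix.mulVec_mulVec, Matrix.mul_nonsing_inv _ ((Matrix.isUnit_iff_isUnit_det _).1 hB),
      Matrix.one_mulVec]
  rw [hx, ← key, h0, dotProduct_zero]

/-- The matrix whose `k`-th row consists of the coordinates of the tensor of
`(a k, b k)` and `(-y k, x k)`. -/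
def tensorMatrix {S : Type*} [CommRing S] (a b x y : Fin 4 → S) : Matrix (Fin 4) (Fin 4) S :=
  Matrix.of fun k => ![-(a k * y k), a k * x k, -(b k * y k), b k * x k]

theorem tensorMatrix_mulVec (a b x y : Fin 4 → ℂ) (α : Fin 4 → ℂ) (k : Fin 4) :
    (tensorMatrix a b x y *ᵥ α) k =
      -(a k * y k) * α 0 + a k * x k * α 1 + -(b k * y k) * α 2 + b k * x k * α 3 := by
  simp [tensorMatrix, Matrix.mulVec, dotProduct, Fin.sum_univ_four]

/-- A quadric contains the ten points exactly when it contains the two skew lines `x₂ = x₃ = 0` and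
`x₀ = x₁ = 0` (on each of which three points are prescribed) and the remaining bilinear form pairs
the two projections of the last four points to zero. -/
theorem exists_standard_quadric_iff {a b x y : Fin 4 → ℂ} (h₂ : a 2 ≠ 0) (h₂' : b 2 ≠ 0)
    {r t : ℂ} (hr : r ≠ 0) (ht : t ≠ 0) :
    (∃ w : Fin 10 → ℂ, w ≠ 0 ∧ veronese ![1, 0, 0, 0] ⬝ᵥ w = 0 ∧ veronese ![0, 1, 0, 0] ⬝ᵥ w = 0 ∧
      veronese ![a 2, b 2, 0, 0] ⬝ᵥ w = 0 ∧ veronese ![0, 0, 1, 0] ⬝ᵥ w = 0 ∧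
      veronese ![0, 0, 0, 1] ⬝ᵥ w = 0 ∧ veronese ![0, 0, r, t] ⬝ᵥ w = 0 ∧
      ∀ k, veronese ![a k, b k, -y k, x k] ⬝ᵥ w = 0) ↔ (tensorMatrix a b x y).det = 0 := by
  rw [← Matrix.exists_mulVec_eq_zero_iff]
  simp only [veronese_dotProduct]
  constructor
  · rintro ⟨w, hw, e0, e1, e2, e3, e4, e5, e6⟩
    simp at e0 e1 e3 e4
    simp [e0, e1, e3, e4, hr, ht, h₂, h₂'] at e2 e5
    refine ⟨![w 5, w 6, w 7, w 8], fun h => hw ?_, ?_⟩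
    · have f5 := congrFun h 0
      have f6 := congrFun h 1
      have f7 := congrFun h 2
      have f8 := congrFun h 3
      simp at f5 f6 f7 f8
      funext i
      fin_cases i <;> simpa
    · funext k
      have := e6 k
      rw [tensorMatrix_mulVec]
      simp [e0, e1, e2, e3, e4, e5] at this ⊢
      linear_combination this
  · rintro ⟨α, hα, h⟩
    refine ⟨![0, 0, 0, 0, 0, α 0, α 1, α 2, α 3, 0], fun h0 => hα ?_, ?_⟩
    · have f5 := congrFun h0 5
      have f6 := congrFun h0 6
      have f7 := congrFun h0 7
      have f8 := congrFun h0 8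
      simp at f5 f6 f7 f8
      funext i
      fin_cases i <;> simpa
    · simp
      intro k
      have := congrFun h k
      rw [tensorMatrix_mulVec] at this
      simp at this
      linear_combination this

/-- The determinant of the images under the Veronese map of ten points, six of which lie on two
skew lines, three on each, vanishes exactly when the determinant of `tensorMatrix` does. -/
theorem det_veronese_eq_zero_iff {u₁ u₂ f₁ f₂ : V4} (hu : LinearIndependent ℂ ![u₁, u₂, f₁, f₂])
    {a b x y : Fin 4 → ℂ} (h₂ : a 2 ≠ 0) (h₂' : b 2 ≠ 0) {r t : ℂ} (hr : r ≠ 0) (ht : t ≠ 0)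
    {e : Fin 4 → V4} (he : ∀ k, e k = a k • u₁ + b k • u₂ - y k • f₁ + x k • f₂) :
    (Matrix.of ![veronese u₁, veronese u₂, veronese (a 2 • u₁ + b 2 • u₂), veronese f₁,
      veronese f₂, veronese (r • f₁ + t • f₂), veronese (e 0), veronese (e 1), veronese (e 2),
      veronese (e 3)])ᵀ.det = 0 ↔ (tensorMatrix a b x y).det = 0 := by
  rw [← exists_standard_quadric_iff h₂ h₂' hr ht, Matrix.det_transpose,
    ← Matrix.exists_mulVec_eq_zero_iff]
  set B : Matrix (Fin 4) (Fin 4) ℂ := (Matrix.of ![u₁, u₂, f₁, f₂])ᵀ with hBdef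
  have hB : IsUnit B := by
    rw [hBdef, Matrix.isUnit_transpose, ← Matrix.linearIndependent_rows_iff_isUnit]
    exact hu
  have hB' : IsUnit B⁻¹ := by
    rw [Matrix.isUnit_nonsing_inv_iff]; exact hB
  have hmul : ∀ s : V4, B *ᵥ s = s 0 • u₁ + s 1 • u₂ + s 2 • f₁ + s 3 • f₂ := fun s => by
    funext j
    simp [hBdef, Matrix.mulVec, dotProduct, Fin.sum_univ_four]
    ring
  have hcancel : ∀ s : V4, B⁻¹ *ᵥ (B *ᵥ s) = s := fun s => by
    rw [Matrix.mulVec_mulVec, Matrix.nonsing_inv_mul _ ((Matrix.isUnit_iff_isUnit_det _).1 hB),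
      Matrix.one_mulVec]
  have p0 : u₁ = B *ᵥ ![1, 0, 0, 0] := by rw [hmul]; simp
  have p1 : u₂ = B *ᵥ ![0, 1, 0, 0] := by rw [hmul]; simp
  have p2 : a 2 • u₁ + b 2 • u₂ = B *ᵥ ![a 2, b 2, 0, 0] := by rw [hmul]; simp
  have p3 : f₁ = B *ᵥ ![0, 0, 1, 0] := by rw [hmul]; simp
  have p4 : f₂ = B *ᵥ ![0, 0, 0, 1] := by rw [hmul]; simp
  have p5 : r • f₁ + t • f₂ = B *ᵥ ![0, 0, r, t] := by rw [hmul]; simp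
  have p6 : ∀ k, e k = B *ᵥ ![a k, b k, -y k, x k] := fun k => by
    rw [hmul, he]; simp [sub_eq_add_neg]
  have hrows : ∀ w : Fin 10 → ℂ, (Matrix.of ![veronese u₁, veronese u₂,
      veronese (a 2 • u₁ + b 2 • u₂), veronese f₁, veronese f₂, veronese (r • f₁ + t • f₂),
      veronese (e 0), veronese (e 1), veronese (e 2), veronese (e 3)]) *ᵥ w = 0 ↔
      veronese u₁ ⬝ᵥ w = 0 ∧ veronese u₂ ⬝ᵥ w = 0 ∧ veronese (a 2 • u₁ + b 2 • u₂) ⬝ᵥ w = 0 ∧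
      veronese f₁ ⬝ᵥ w = 0 ∧ veronese f₂ ⬝ᵥ w = 0 ∧ veronese (r • f₁ + t • f₂) ⬝ᵥ w = 0 ∧
      ∀ k, veronese (e k) ⬝ᵥ w = 0 := fun w => by
    rw [funext_iff]
    simp only [Fin.forall_fin_succ, IsEmpty.forall_iff, Matrix.mulVec, and_true]
    rfl
  simp only [hrows]
  constructor
  · rintro ⟨w, hw, e0, e1, e2, e3, e4, e5, e6⟩
    obtain ⟨w', hw', h⟩ := exists_quadric_comp_mulVec B hB hw
    refine ⟨w', hw', ?_⟩
    simp only [h, ← p0, ← p1, ← p2, ← p3, ← p4, ← p5, ← p6]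
    exact ⟨e0, e1, e2, e3, e4, e5, e6⟩
  · rintro ⟨w, hw, e0, e1, e2, e3, e4, e5, e6⟩
    obtain ⟨w', hw', h⟩ := exists_quadric_comp_mulVec B⁻¹ hB' hw
    refine ⟨w', hw', ?_⟩
    rw [p2, p5]
    simp only [p6]
    rw [p0, p1, p3, p4]
    simp only [h, hcancel]
    exact ⟨e0, e1, e2, e3, e4, e5, e6⟩

/-! ### Evaluating the determinants -/

variable {m : ℕ} {C : Fin m → Matrix (Fin 3) (Fin 4) ℂ}

/-- Evaluation of a polynomial at a tuple of vectors of homogeneous coordinates. -/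
abbrev evalAt (v : Fin m → Fin 3 → ℂ) : R m →+* ℂ :=
  MvPolynomial.eval fun p : Fin m × Fin 3 => v p.1 p.2

theorem evalAt_backPlane (v : Fin m → Fin 3 → ℂ) (i : Fin m) (j : Fin 4) :
    evalAt v (backPlane C i j) = ((C i)ᵀ *ᵥ v i) j := by
  simp [backPlane, Matrix.mulVec, dotProduct]

theorem evalAt_backPlane_dotProduct (v : Fin m → Fin 3 → ℂ) (i : Fin m) (z : V4) :
    evalAt v (backPlane C i ⬝ᵥ const m z) = v i ⬝ᵥ C i *ᵥ z := by
  rw [RingHom.map_dotProduct, Matrix.dotProduct_mulVec, ← Matrix.mulVec_transpose]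
  congr 1
  · funext j; exact evalAt_backPlane v i j
  · funext j; simp [const]

theorem map_veronese {S T : Type*} [CommRing S] [CommRing T] (φ : S →+* T) (p : Fin 4 → S)
    (i : Fin 10) : φ (veronese p i) = veronese (fun j => φ (p j)) i := by
  fin_cases i <;> simp [veronese]

theorem evalAt_e (v : Fin m → Fin 3 → ℂ) (c : Fin m → V4) (f : Fin 3 → V4) (i : Fin m) :
    (fun j => evalAt v (e C c f i j)) =
      c i - (v i ⬝ᵥ C i *ᵥ f 1) • f 0 + (v i ⬝ᵥ C i *ᵥ f 0) • f 1 := by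
  funext j
  simp only [e, Pi.add_apply, Pi.sub_apply, Pi.smul_apply, smul_eq_mul, map_add, map_sub, map_mul,
    evalAt_backPlane_dotProduct]
  simp [const]

theorem evalAt_det_Phi (v : Fin m → Fin 3 → ℂ) (c : Fin m → V4) (f : Fin 3 → V4)
    (σ : Fin 4 ↪o Fin m) (p : Fin 4 → V4)
    (hp : ∀ k, p k = c (σ k) - (v (σ k) ⬝ᵥ C (σ k) *ᵥ f 1) • f 0 +
      (v (σ k) ⬝ᵥ C (σ k) *ᵥ f 0) • f 1) :
    evalAt v (Phi C c f σ).det =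
      (Matrix.of ![veronese (c (σ 0)), veronese (c (σ 1)), veronese (c (σ 2)), veronese (f 0),
        veronese (f 1), veronese (f 2), veronese (p 0), veronese (p 1), veronese (p 2),
        veronese (p 3)])ᵀ.det := by
  have hconst : ∀ z : V4, (fun j => evalAt v (const m z j)) = z := fun z => by
    funext j; simp [const]
  rw [RingHom.map_det]
  congr 1
  ext i j
  simp only [RingHom.mapMatrix_apply, Matrix.map_apply, Phi, Matrix.transpose_apply,
    Matrix.of_apply]
  fin_cases j
  all_goals
    refine (map_veronese _ _ _).trans ?_
    simp only [hconst, evalAt_e, ← hp]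
    rfl

/-- For four collinear cameras, the vanishing of `det Φ` is the vanishing of the determinant of the
tensors of the centers (in coordinates `a`, `b` on the baseline) and the points in which the planes
`h_k` meet the dual line. -/
theorem exists_det_Phi_eq_zero_iff
    (hdistinct : ∀ i j, i ≠ j → center (C i) ≠ center (C j))
    {c : Fin m → V4} (hc : ∀ i, IsCenterVector (C i) (c i)) {σ : Fin 4 ↪o Fin m}
    (hσ : IsCollinear C σ) {f : Fin 3 → V4} (hf : IsDualTriple (baseline C σ) f) :
    ∃ a b : Fin 4 → ℂ, (∀ k, c (σ k) = a k • c (σ 0) + b k • c (σ 1)) ∧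
      LinearIndependent ℂ ![c (σ 0), c (σ 1), f 0, f 1] ∧
      ∀ v : Fin m → Fin 3 → ℂ, evalAt v (Phi C c f σ).det = 0 ↔
        (tensorMatrix a b (fun k => v (σ k) ⬝ᵥ C (σ k) *ᵥ f 0)
          (fun k => v (σ k) ⬝ᵥ C (σ k) *ᵥ f 1)).det = 0 := by
  obtain ⟨E, hE, hcE⟩ := hσ
  obtain ⟨F, hF, hdisj, hfF, hfi⟩ := hf
  have hmem : ∀ k, c (σ k) ∈ center (C (σ k)) := fun k => by
    rw [← (hc (σ k)).2]; exact Submodule.mem_span_singleton_self _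
  have hind : ∀ k l, k ≠ l → LinearIndependent ℂ ![c (σ k), c (σ l)] := fun k l hkl =>
    linearIndependent_centers (hc _) (hc _) (hdistinct _ _ (σ.injective.ne hkl))
  have hcoord : ∀ k, ∃ a b : ℂ, c (σ k) = a • c (σ 0) + b • c (σ 1) := fun k =>
    exists_eq_smul_add_smul hE (hcE 0 (hmem 0)) (hcE 1 (hmem 1)) (hind 0 1 (by decide))
      (hcE k (hmem k))
  choose a b hab using hcoord
  obtain ⟨r, t, hrt⟩ := exists_eq_smul_add_smul hF (hfF 0) (hfF 1) (hfi 0 1 (by decide)) (hfF 2)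
  have hr : r ≠ 0 := by
    rintro rfl
    have := LinearIndependent.pair_iff.1 (hfi 1 2 (by decide)) t (-1) (by rw [hrt]; simp)
    simp at this
  have ht : t ≠ 0 := by
    rintro rfl
    have := LinearIndependent.pair_iff.1 (hfi 0 2 (by decide)) r (-1) (by rw [hrt]; simp)
    simp at this
  have ha : a 2 ≠ 0 := by
    intro h0
    have := LinearIndependent.pair_iff.1 (hind 1 2 (by decide)) (b 2) (-1) (by
      rw [hab 2, h0]; simp)
    simp at this
  have hb : b 2 ≠ 0 := by
    intro h0
    have := LinearIndependent.pair_iff.1 (hind 0 2 (by decide)) (a 2) (-1) (by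
      rw [hab 2, h0]; simp)
    simp at this
  have hli : LinearIndependent ℂ ![c (σ 0), c (σ 1), f 0, f 1] := by
    have hbase : ∀ k, c (σ k) ∈ baseline C σ := fun k =>
      (le_iSup (fun k => center (C (σ k))) k) (hmem k)
    rw [Fintype.linearIndependent_iff]
    intro g hg
    simp only [Fin.sum_univ_four, Matrix.cons_val] at hg
    have hz : g 2 • f 0 + g 3 • f 1 = 0 := by
      refine Submodule.disjoint_def.1 hdisj _
        (F.add_mem (F.smul_mem _ (hfF 0)) (F.smul_mem _ (hfF 1))) ?_
      have : g 2 • f 0 + g 3 • f 1 = -(g 0 • c (σ 0) + g 1 • c (σ 1)) := by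
        rw [eq_neg_iff_add_eq_zero, ← hg]; abel
      rw [this]
      exact Submodule.neg_mem _ (Submodule.add_mem _ (Submodule.smul_mem _ _ (hbase 0))
        (Submodule.smul_mem _ _ (hbase 1)))
    have hz' : g 0 • c (σ 0) + g 1 • c (σ 1) = 0 := by
      rw [add_assoc, hz, add_zero] at hg
      exact hg
    obtain ⟨h2, h3⟩ := LinearIndependent.pair_iff.1 (hfi 0 1 (by decide)) _ _ hz
    obtain ⟨h0, h1⟩ := LinearIndependent.pair_iff.1 (hind 0 1 (by decide)) _ _ hz'
    intro i
    fin_cases i <;> assumption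
  refine ⟨a, b, hab, hli, fun v => ?_⟩
  obtain ⟨p, hp⟩ : ∃ p : Fin 4 → V4, ∀ k, p k = c (σ k) - (v (σ k) ⬝ᵥ C (σ k) *ᵥ f 1) • f 0 +
      (v (σ k) ⬝ᵥ C (σ k) *ᵥ f 0) • f 1 := ⟨_, fun _ => rfl⟩
  have hp' : ∀ k, p k = a k • c (σ 0) + b k • c (σ 1) - (v (σ k) ⬝ᵥ C (σ k) *ᵥ f 1) • f 0 +
      (v (σ k) ⬝ᵥ C (σ k) *ᵥ f 0) • f 1 := fun k => by rw [← hab, hp]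
  have key := det_veronese_eq_zero_iff hli ha hb hr ht hp'
  rw [← hab, ← hrt] at key
  rw [evalAt_det_Phi v c f σ p hp, key]

/-! ### The zero locus is closed -/

theorem isWeightedHomogeneous_det {n : ℕ} {N : Matrix (Fin n) (Fin n) (R m)}
    {w : Fin m × Fin 3 → Fin m → ℕ} {d : Fin n → Fin m → ℕ}
    (h : ∀ i j, MvPolynomial.IsWeightedHomogeneous w (N i j) (d j)) :
    MvPolynomial.IsWeightedHomogeneous w N.det (∑ j, d j) := by
  rw [Matrix.det_apply]
  refine MvPolynomial.IsWeightedHomogeneous.sum _ _ _ fun τ _ => ?_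
  have := MvPolynomial.IsWeightedHomogeneous.prod Finset.univ (fun i => N (τ i) i) d
    fun i _ => h (τ i) i
  rcases Int.units_eq_one_or (Equiv.Perm.sign τ) with hs | hs
  · rw [hs, one_smul]; exact this
  · rw [hs, Units.neg_smul, one_smul]; exact this.neg

theorem isWeightedHomogeneous_C_mul {w : Fin m × Fin 3 → Fin m → ℕ} {F : R m} {d : Fin m → ℕ}
    (r : ℂ) (h : MvPolynomial.IsWeightedHomogeneous w F d) :
    MvPolynomial.IsWeightedHomogeneous w (MvPolynomial.C r * F) d := by
  simpa using (MvPolynomial.isWeightedHomogeneous_C w r).mul h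

theorem isWeightedHomogeneous_backPlane (i : Fin m) (j : Fin 4) :
    MvPolynomial.IsWeightedHomogeneous
      (fun p : Fin m × Fin 3 => (Pi.single p.1 1 : Fin m → ℕ)) (backPlane C i j)
      (Pi.single i 1) := by
  refine MvPolynomial.IsWeightedHomogeneous.sum _ _ _ fun k _ => ?_
  exact isWeightedHomogeneous_C_mul _ (MvPolynomial.isWeightedHomogeneous_X ℂ _ (i, k))

theorem isWeightedHomogeneous_backPlane_dotProduct (i : Fin m) (z : V4) :
    MvPolynomial.IsWeightedHomogeneous
      (fun p : Fin m × Fin 3 => (Pi.single p.1 1 : Fin m → ℕ)) (backPlane C i ⬝ᵥ const m z)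
      (Pi.single i 1) := by
  refine MvPolynomial.IsWeightedHomogeneous.sum _ _ _ fun k _ => ?_
  rw [mul_comm]
  exact isWeightedHomogeneous_C_mul _ (isWeightedHomogeneous_backPlane i k)

theorem isMultihomogeneous_of_mem_minors {F : R m} (hF : F ∈ minors C) : IsMultihomogeneous F := by
  obtain ⟨r, s, rfl⟩ := hF
  exact ⟨_, isWeightedHomogeneous_det fun i j => isWeightedHomogeneous_backPlane (s j) (r i)⟩

/-- The polynomial version of `tensorMatrix`: its determinant is a multihomogeneous replacement
for `det Φ`. -/
def tensorPoly (C : Fin m → Matrix (Fin 3) (Fin 4) ℂ) (a b : Fin 4 → ℂ) (f : Fin 3 → V4)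
    (σ : Fin 4 ↪o Fin m) : R m :=
  (tensorMatrix (fun k => MvPolynomial.C (a k)) (fun k => MvPolynomial.C (b k))
    (fun k => backPlane C (σ k) ⬝ᵥ const m (f 0))
    (fun k => backPlane C (σ k) ⬝ᵥ const m (f 1))).det

theorem isMultihomogeneous_tensorPoly (a b : Fin 4 → ℂ) (f : Fin 3 → V4)
    (σ : Fin 4 ↪o Fin m) : IsMultihomogeneous (tensorPoly C a b f σ) := by
  refine ⟨∑ k, Pi.single (σ k) 1, ?_⟩
  rw [tensorPoly, ← Matrix.det_transpose]
  refine isWeightedHomogeneous_det fun i k => ?_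
  have h := fun r l => isWeightedHomogeneous_C_mul r
    (isWeightedHomogeneous_backPlane_dotProduct (C := C) (σ k) (f l))
  fin_cases i
  · exact (h (a k) 1).neg
  · exact h (a k) 0
  · exact (h (b k) 1).neg
  · exact h (b k) 0

theorem evalAt_tensorPoly (v : Fin m → Fin 3 → ℂ) (a b : Fin 4 → ℂ) (f : Fin 3 → V4)
    (σ : Fin 4 ↪o Fin m) :
    evalAt v (tensorPoly C a b f σ) =
      (tensorMatrix a b (fun k => v (σ k) ⬝ᵥ C (σ k) *ᵥ f 0)
        (fun k => v (σ k) ⬝ᵥ C (σ k) *ᵥ f 1)).det := by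
  rw [tensorPoly, RingHom.map_det]
  congr 1
  ext k j
  have h := fun l => evalAt_backPlane_dotProduct (C := C) v (σ k) (f l)
  rw [RingHom.mapMatrix_apply, Matrix.map_apply]
  fin_cases j <;> simp [tensorMatrix, h]

theorem mem_zeroLocus_extendedIdeal {c : Fin m → V4} {f : (Fin 4 ↪o Fin m) → Fin 3 → V4}
    {l : Fin m → P2} :
    l ∈ zeroLocus (extendedIdeal C c f : Set (R m)) ↔
      ∀ (v : Fin m → Fin 3 → ℂ) (hv : ∀ i, v i ≠ 0),
        (∀ i, Projectivization.mk ℂ (v i) (hv i) = l i) →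
        (∀ F ∈ minors C, evalAt v F = 0) ∧
        ∀ σ, IsCollinear C σ → evalAt v (Phi C c (f σ) σ).det = 0 := by
  constructor
  · intro h v hv hl
    refine ⟨fun F hF => h F ?_ v hv hl, fun σ hσ => h _ ?_ v hv hl⟩
    · exact Ideal.mem_sup_left (Ideal.subset_span hF)
    · refine Ideal.mem_sup_right ?_
      exact (le_iSup₂_of_le (f := fun (σ : Fin 4 ↪o Fin m) (_ : IsCollinear C σ) =>
        Ideal.span {(Phi C c (f σ) σ).det}) σ hσ le_rfl) (Ideal.mem_span_singleton_self _)
  · intro h F hF v hv hl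
    obtain ⟨h1, h2⟩ := h v hv hl
    have hle : extendedIdeal C c f ≤ RingHom.ker (evalAt v) := by
      refine sup_le (Ideal.span_le.2 fun F hF => h1 F hF) (iSup₂_le fun σ hσ => ?_)
      rw [Ideal.span_le, Set.singleton_subset_iff]
      exact h2 σ hσ
    exact hle hF

theorem isZariskiClosed_zeroLocus
    (hdistinct : ∀ i j, i ≠ j → center (C i) ≠ center (C j))
    {c : Fin m → V4} (hc : ∀ i, IsCenterVector (C i) (c i)) {f : (Fin 4 ↪o Fin m) → Fin 3 → V4}
    (hf : ∀ σ, IsCollinear C σ → IsDualTriple (baseline C σ) (f σ)) :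
    IsZariskiClosed (zeroLocus (extendedIdeal C c f : Set (R m))) := by
  choose! a b _ _ hD using fun σ hσ => exists_det_Phi_eq_zero_iff hdistinct hc hσ (hf σ hσ)
  refine ⟨minors C ∪ {F | ∃ σ, IsCollinear C σ ∧ F = tensorPoly C (a σ) (b σ) (f σ) σ}, ?_, ?_⟩
  · rintro F (hF | ⟨σ, -, rfl⟩)
    · exact isMultihomogeneous_of_mem_minors hF
    · exact isMultihomogeneous_tensorPoly _ _ _ _
  · ext l
    rw [mem_zeroLocus_extendedIdeal]
    constructor
    · rintro h F (hF | ⟨σ, hσ, rfl⟩) v hv hl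
      · exact (h v hv hl).1 F hF
      · exact (evalAt_tensorPoly v _ _ _ _).trans ((hD σ hσ v).1 ((h v hv hl).2 σ hσ))
    · intro h v hv hl
      refine ⟨fun F hF => h F (Or.inl hF) v hv hl, fun σ hσ => (hD σ hσ v).2 ?_⟩
      rw [← evalAt_tensorPoly]
      exact h _ (Or.inr ⟨σ, hσ, rfl⟩) v hv hl

/-! ### Rank and minors -/

theorem exists_minor_ne_zero {N : Matrix (Fin 4) (Fin m) ℂ} (h : 3 ≤ N.rank) :
    ∃ (r : Fin 3 ↪o Fin 4) (s : Fin 3 ↪o Fin m), (N.submatrix r s).det ≠ 0 := by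
  rw [Matrix.rank_eq_finrank_span_cols] at h
  obtain ⟨s, hs⟩ := exists_orderEmb_linearIndependent N.col h
  have h3 : 3 ≤ (N.submatrix id s).rank := by
    have : (N.submatrix id s).col = N.col ∘ s := rfl
    rw [Matrix.rank_eq_finrank_span_cols, this, finrank_span_eq_card hs, Fintype.card_fin]
  rw [Matrix.rank_eq_finrank_span_row] at h3
  obtain ⟨r, hr⟩ := exists_orderEmb_linearIndependent (N.submatrix id s).row h3
  refine ⟨r, s, ?_⟩
  rw [← isUnit_iff_ne_zero, ← Matrix.isUnit_iff_isUnit_det,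
    ← Matrix.linearIndependent_rows_iff_isUnit]
  exact hr

theorem le_rank_of_minor_ne_zero {N : Matrix (Fin 4) (Fin m) ℂ} {r : Fin 3 → Fin 4}
    {s : Fin 3 → Fin m} (h : (N.submatrix r s).det ≠ 0) : 3 ≤ N.rank := by
  rw [← isUnit_iff_ne_zero, ← Matrix.isUnit_iff_isUnit_det] at h
  have h1 := Matrix.rank_of_isUnit _ h
  rw [Fintype.card_fin] at h1
  exact h1.symm.le.trans (Matrix.rank_submatrix_le N r s)

theorem rank_add_finrank_ker_transpose (N : Matrix (Fin 4) (Fin m) ℂ) :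
    N.rank + Module.finrank ℂ (LinearMap.ker Nᵀ.mulVecLin) = 4 := by
  rw [← Matrix.rank_transpose, Matrix.rank, LinearMap.finrank_range_add_finrank_ker]
  simp

/-- The value of `M(ℓ)` at a tuple of vectors. -/
def evalM (C : Fin m → Matrix (Fin 3) (Fin 4) ℂ) (v : Fin m → Fin 3 → ℂ) :
    Matrix (Fin 4) (Fin m) ℂ :=
  Matrix.of fun j i => ((C i)ᵀ *ᵥ v i) j

theorem transpose_mulVec_dotProduct (A : Matrix (Fin 3) (Fin 4) ℂ) (v : Fin 3 → ℂ) (z : V4) :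
    (Aᵀ *ᵥ v) ⬝ᵥ z = v ⬝ᵥ A *ᵥ z := by
  rw [Matrix.dotProduct_mulVec, ← Matrix.mulVec_transpose]

theorem mem_ker_evalM {v : Fin m → Fin 3 → ℂ} {z : V4} :
    z ∈ LinearMap.ker (evalM C v)ᵀ.mulVecLin ↔ ∀ i, v i ⬝ᵥ C i *ᵥ z = 0 := by
  rw [LinearMap.mem_ker, Matrix.mulVecLin_apply, funext_iff]
  simp only [← transpose_mulVec_dotProduct]
  rfl

theorem evalAt_minor (v : Fin m → Fin 3 → ℂ) (r : Fin 3 → Fin 4) (s : Fin 3 → Fin m) :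
    evalAt v ((M C).submatrix r s).det = ((evalM C v).submatrix r s).det := by
  rw [RingHom.map_det]
  congr 1
  ext i j
  exact evalAt_backPlane v (s j) (r i)

/-- The `3 × 3` minors of `M(ℓ)` vanish exactly when the back-projected planes have a line in
common. -/
theorem forall_minors_iff (v : Fin m → Fin 3 → ℂ) :
    (∀ F ∈ minors C, evalAt v F = 0) ↔
      ∃ p q : V4, LinearIndependent ℂ ![p, q] ∧
        ∀ i, v i ⬝ᵥ C i *ᵥ p = 0 ∧ v i ⬝ᵥ C i *ᵥ q = 0 := by
  have hrank := rank_add_finrank_ker_transpose (evalM C v)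
  constructor
  · intro h
    have hlt : ¬ 3 ≤ (evalM C v).rank := fun h3 => by
      obtain ⟨r, s, hrs⟩ := exists_minor_ne_zero h3
      exact hrs (by rw [← evalAt_minor]; exact h _ ⟨r, s, rfl⟩)
    have h2 : 2 ≤ Module.finrank ℂ (LinearMap.ker (evalM C v)ᵀ.mulVecLin) := by omega
    have hli := ((Module.finBasis ℂ (LinearMap.ker (evalM C v)ᵀ.mulVecLin)).linearIndependent.comp
      _ (Fin.castLE_injective h2)).map' _ (Submodule.ker_subtype _)
    obtain ⟨g, hg, hgli⟩ : ∃ g : Fin 2 → V4, (∀ k, ∀ i, v i ⬝ᵥ C i *ᵥ g k = 0) ∧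
        LinearIndependent ℂ g := ⟨_, fun k => mem_ker_evalM.1 (Subtype.mem _), hli⟩
    refine ⟨g 0, g 1, ?_, fun i => ⟨hg 0 i, hg 1 i⟩⟩
    rwa [show ![g 0, g 1] = g from List.ofFn_inj.1 rfl]
  · rintro ⟨p, q, hpq, h⟩ F ⟨r, s, rfl⟩
    rw [evalAt_minor]
    by_contra hne
    have h3 := le_rank_of_minor_ne_zero hne
    have hle : Submodule.span ℂ (Set.range ![p, q]) ≤ LinearMap.ker (evalM C v)ᵀ.mulVecLin := by
      rw [Submodule.span_le]
      rintro _ ⟨k, rfl⟩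
      refine mem_ker_evalM.2 fun i => ?_
      fin_cases k
      · exact (h i).1
      · exact (h i).2
    have h2 : 2 ≤ Module.finrank ℂ (LinearMap.ker (evalM C v)ᵀ.mulVecLin) := by
      refine le_trans (le_of_eq ?_) (Submodule.finrank_mono hle)
      rw [finrank_span_eq_card hpq, Fintype.card_fin]
    omega

/-! ### The image of the joint camera map satisfies the equations -/

/-- The linear form `z ↦ det(z, c, p, q)` of the plane through `c`, `p` and `q`. -/
def planeForm (c p q z : V4) : ℂ := (Matrix.of ![z, c, p, q]).det

theorem planeForm_eq (c p q z : V4) : planeForm c p q z =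
    z 0 * (c 1 * (p 2 * q 3 - p 3 * q 2) - c 2 * (p 1 * q 3 - p 3 * q 1)
      + c 3 * (p 1 * q 2 - p 2 * q 1))
    - z 1 * (c 0 * (p 2 * q 3 - p 3 * q 2) - c 2 * (p 0 * q 3 - p 3 * q 0)
      + c 3 * (p 0 * q 2 - p 2 * q 0))
    + z 2 * (c 0 * (p 1 * q 3 - p 3 * q 1) - c 1 * (p 0 * q 3 - p 3 * q 0)
      + c 3 * (p 0 * q 1 - p 1 * q 0))
    - z 3 * (c 0 * (p 1 * q 2 - p 2 * q 1) - c 1 * (p 0 * q 2 - p 2 * q 0)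
      + c 2 * (p 0 * q 1 - p 1 * q 0)) := by
  rw [planeForm, Matrix.det_succ_row_zero]
  simp [Fin.sum_univ_four, Matrix.det_fin_three, Fin.succAbove, Matrix.submatrix_apply]
  ring

theorem planeForm_add_smul (u₁ u₂ p q z : V4) (a b : ℂ) :
    planeForm (a • u₁ + b • u₂) p q z = a * planeForm u₁ p q z + b * planeForm u₂ p q z := by
  simp only [planeForm_eq, Pi.add_apply, Pi.smul_apply, smul_eq_mul]
  ring

/-- A linear form vanishing at `c`, `p`, `q` is proportional to `planeForm c p q`. -/
theorem dotProduct_mul_planeForm {h c p q : V4} (hc : h ⬝ᵥ c = 0) (hp : h ⬝ᵥ p = 0)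
    (hq : h ⬝ᵥ q = 0) (y z : V4) :
    h ⬝ᵥ z * planeForm c p q y = h ⬝ᵥ y * planeForm c p q z := by
  -- Cramer's relation between five vectors of a four-dimensional space
  have key : h ⬝ᵥ z * planeForm c p q y - h ⬝ᵥ y * planeForm c p q z =
      h ⬝ᵥ c * planeForm z p q y + h ⬝ᵥ p * planeForm c z q y + h ⬝ᵥ q * planeForm c p z y := by
    simp only [planeForm_eq, dotProduct, Fin.sum_univ_four]
    ring
  rw [hc, hp, hq] at key
  linear_combination key

theorem exists_planeForm_ne_zero {c p q : V4} (h : LinearIndependent ℂ ![c, p, q]) :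
    ∃ z, planeForm c p q z ≠ 0 := by
  obtain ⟨z, hz⟩ := exists_linearIndependent_cons_of_lt_finrank (R := ℂ) h
    (by rw [Module.finrank_fin_fun]; norm_num)
  refine ⟨z, ?_⟩
  rw [planeForm, ← isUnit_iff_ne_zero, ← Matrix.isUnit_iff_isUnit_det,
    ← Matrix.linearIndependent_rows_iff_isUnit]
  exact hz

/-- The bilinear form on the two lines `⟨u₁, u₂⟩` and `⟨f₁, f₂⟩` that a common line `⟨p, q⟩` of
the planes `h k` induces is a vector in the kernel of `tensorMatrix`. -/
theorem det_tensorMatrix_eq_zero {u₁ u₂ f₁ f₂ p q : V4} {a b : Fin 4 → ℂ} {h c : Fin 4 → V4}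
    (hcab : ∀ k, c k = a k • u₁ + b k • u₂) (hc : ∀ k, h k ⬝ᵥ c k = 0)
    (hp : ∀ k, h k ⬝ᵥ p = 0) (hq : ∀ k, h k ⬝ᵥ q = 0)
    (hli : ∀ k, LinearIndependent ℂ ![c k, p, q]) :
    (tensorMatrix a b (fun k => h k ⬝ᵥ f₁) (fun k => h k ⬝ᵥ f₂)).det = 0 := by
  rw [← Matrix.exists_mulVec_eq_zero_iff]
  have hprop := fun k => dotProduct_mul_planeForm (hc k) (hp k) (hq k)
  by_cases h0 : ![planeForm u₁ p q f₁, planeForm u₁ p q f₂, planeForm u₂ p q f₁,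
      planeForm u₂ p q f₂] = 0
  · -- the form is zero: then every plane `h k` contains `f₁` and `f₂`
    have z0 := congrFun h0 0
    have z1 := congrFun h0 1
    have z2 := congrFun h0 2
    have z3 := congrFun h0 3
    simp at z0 z1 z2 z3
    have hf : ∀ k, h k ⬝ᵥ f₁ = 0 ∧ h k ⬝ᵥ f₂ = 0 := fun k => by
      obtain ⟨y, hy⟩ := exists_planeForm_ne_zero (hli k)
      have e1 := hprop k y f₁
      have e2 := hprop k y f₂
      have w1 : planeForm (c k) p q f₁ = 0 := by rw [hcab k, planeForm_add_smul, z0, z2]; ring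
      have w2 : planeForm (c k) p q f₂ = 0 := by rw [hcab k, planeForm_add_smul, z1, z3]; ring
      rw [w1, mul_zero] at e1
      rw [w2, mul_zero] at e2
      simpa [hy] using And.intro e1 e2
    refine ⟨Pi.single 0 1, by simp, ?_⟩
    funext k
    simp [tensorMatrix_mulVec, hf]
  · refine ⟨_, h0, ?_⟩
    funext k
    have e := hprop k f₁ f₂
    rw [hcab k, planeForm_add_smul, planeForm_add_smul] at e
    simp only [tensorMatrix_mulVec, Matrix.cons_val, Pi.zero_apply]
    linear_combination -e

theorem jointImage_subset_zeroLocus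
    (hdistinct : ∀ i j, i ≠ j → center (C i) ≠ center (C j))
    {c : Fin m → V4} (hc : ∀ i, IsCenterVector (C i) (c i)) {f : (Fin 4 ↪o Fin m) → Fin 3 → V4}
    (hf : ∀ σ, IsCollinear C σ → IsDualTriple (baseline C σ) (f σ)) :
    jointImage C ⊆ zeroLocus (extendedIdeal C c f : Set (R m)) := by
  rintro l ⟨L, hL, p, q, hpq, hl⟩
  rw [mem_zeroLocus_extendedIdeal]
  intro v hv hvl
  have hli : LinearIndependent ℂ ![p, q] := by
    rw [linearIndependent_iff_card_eq_finrank_span, Matrix.range_cons_cons_empty, Set.finrank,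
      hpq, hL, Fintype.card_fin]
  have hprop : ∀ i, ∃ s : ℂ, v i = s • ((C i *ᵥ p) ⨯₃ (C i *ᵥ q)) := fun i => by
    obtain ⟨h, hi⟩ := hl i
    obtain ⟨s, hs⟩ := (Projectivization.mk_eq_mk_iff' ℂ _ _ (hv i) h).1 ((hvl i).trans hi)
    exact ⟨s, hs.symm⟩
  have horth : ∀ i, v i ⬝ᵥ C i *ᵥ p = 0 ∧ v i ⬝ᵥ C i *ᵥ q = 0 := fun i => by
    obtain ⟨s, hs⟩ := hprop i
    rw [hs, smul_dotProduct, smul_dotProduct, dotProduct_comm, dot_self_cross, dotProduct_comm,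
      dot_cross_self]
    simp
  refine ⟨(forall_minors_iff v).2 ⟨p, q, hli, horth⟩, fun σ hσ => ?_⟩
  obtain ⟨a, b, hab, -, hD⟩ := exists_det_Phi_eq_zero_iff hdistinct hc hσ (hf σ hσ)
  rw [hD]
  simp only [← transpose_mulVec_dotProduct]
  refine det_tensorMatrix_eq_zero (c := fun k => c (σ k)) (p := p) (q := q) hab ?_ ?_ ?_ ?_
  · intro k
    rw [transpose_mulVec_dotProduct, (hc _).mulVec_eq_zero, dotProduct_zero]
  · intro k
    rw [transpose_mulVec_dotProduct, (horth _).1]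
  · intro k
    rw [transpose_mulVec_dotProduct, (horth _).2]
  · intro k
    obtain ⟨h, -⟩ := hl (σ k)
    exact (hc _).linearIndependent h

/-! ### Deforming a line through camera centers -/

/-- If `det (tensorMatrix …)` vanishes, then the tensors of the points `a k u₁ + b k u₂` and the
planes `h k` are dependent in any coordinates: `A₁`, `A₂` are the values of an arbitrary linear form
at `u₁`, `u₂`, and `z` is an arbitrary point, not only one of `⟨f₁, f₂⟩`. -/
theorem exists_tensor_relation {u₁ u₂ f₁ f₂ : V4} {a b : Fin 4 → ℂ} {h : Fin 4 → V4}
    (hli : LinearIndependent ℂ ![u₁, u₂, f₁, f₂]) (h₁ : ∀ k, h k ⬝ᵥ u₁ = 0)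
    (h₂ : ∀ k, h k ⬝ᵥ u₂ = 0)
    (hdet : (tensorMatrix a b (fun k => h k ⬝ᵥ f₁) (fun k => h k ⬝ᵥ f₂)).det = 0) :
    ∃ μ : Fin 4 → ℂ, μ ≠ 0 ∧ ∀ (A₁ A₂ : ℂ) (z : V4),
      ∑ k, μ k * ((a k * A₁ + b k * A₂) * (h k ⬝ᵥ z)) = 0 := by
  rw [← Matrix.exists_vecMul_eq_zero_iff] at hdet
  obtain ⟨μ, hμ, h0⟩ := hdet
  refine ⟨μ, hμ, fun A₁ A₂ z => ?_⟩
  obtain ⟨s, hs⟩ := exists_coords hli z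
  have e0 := congrFun h0 0
  have e1 := congrFun h0 1
  have e2 := congrFun h0 2
  have e3 := congrFun h0 3
  simp [tensorMatrix, Matrix.vecMul, dotProduct, -Finset.sum_neg_distrib] at e0 e1 e2 e3
  have hz : ∀ k, h k ⬝ᵥ z = s 2 * (h k ⬝ᵥ f₁) + s 3 * (h k ⬝ᵥ f₂) := fun k => by
    rw [hs]; simp [dotProduct_add, h₁, h₂]
  simp only [hz]
  simp only [dotProduct] at e0 e1 e2 e3 ⊢
  simp only [Fin.sum_univ_four (M := ℂ)] at e0 e1 e2 e3 ⊢
  linear_combination -A₁ * s 3 * e0 + A₁ * s 2 * e1 - A₂ * s 3 * e2 + A₂ * s 2 * e3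

/-- The curve `x + ε y + ε² z` of vectors. -/
def curve (x y z : V4) (ε : ℂ) : V4 := x + ε • y + ε ^ 2 • z

/-- The image under a camera `A` of a line moving with the parameter is a polynomial curve. -/
theorem exists_polynomial_cross (A : Matrix (Fin 3) (Fin 4) ℂ) (x y z x' y' z' : V4) :
    ∃ G : Fin 3 → Polynomial ℂ, ∀ ε, (fun j => (G j).eval ε) =
      (A *ᵥ curve x y z ε) ⨯₃ (A *ᵥ curve x' y' z' ε) := by
  have h : ∀ x y z : V4, ∃ G : Fin 3 → Polynomial ℂ, ∀ ε j,
      (G j).eval ε = (A *ᵥ curve x y z ε) j := fun x y z => by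
    refine ⟨fun j => Polynomial.C ((A *ᵥ x) j) + Polynomial.C ((A *ᵥ y) j) * Polynomial.X +
      Polynomial.C ((A *ᵥ z) j) * Polynomial.X ^ 2, fun ε j => ?_⟩
    simp [curve, Matrix.mulVec_add, Matrix.mulVec_smul]
    ring
  obtain ⟨F, hF⟩ := h x y z
  obtain ⟨F', hF'⟩ := h x' y' z'
  refine ⟨F ⨯₃ F', fun ε => ?_⟩
  funext j
  rw [cross_apply, cross_apply]
  fin_cases j <;> simp [hF, hF']

/-- `v` is, up to scale, the limit for `ε → 0` of the image under `A` of the moving line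
`⟨P ε, Q ε⟩`: after division by a power of `ε` the image is a polynomial curve through `v`. -/
def IsLimit (A : Matrix (Fin 3) (Fin 4) ℂ) (v : Fin 3 → ℂ) (P Q : ℂ → V4) : Prop :=
  ∃ (k : ℕ) (s : ℂ) (G : Fin 3 → Polynomial ℂ), s ≠ 0 ∧ (fun j => (G j).eval 0) = v ∧
    ∀ ε, (A *ᵥ P ε) ⨯₃ (A *ᵥ Q ε) = (s * ε ^ k) • fun j => (G j).eval ε

/-- A moving line whose image is a power of `ε` times the image of a moving line that misses the
center at `ε = 0` has the image of the latter as its limit. -/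
theorem isLimit_of_factor {A : Matrix (Fin 3) (Fin 4) ℂ} {c : V4} (hc : IsCenterVector A c)
    {v : Fin 3 → ℂ} (hv : v ≠ 0) {P Q : ℂ → V4} (k : ℕ) {x y z x' y' z' : V4}
    (hfac : ∀ ε, (A *ᵥ P ε) ⨯₃ (A *ᵥ Q ε) =
      ε ^ k • ((A *ᵥ curve x y z ε) ⨯₃ (A *ᵥ curve x' y' z' ε)))
    (hx : v ⬝ᵥ A *ᵥ x = 0) (hx' : v ⬝ᵥ A *ᵥ x' = 0) (hli : LinearIndependent ℂ ![c, x, x']) :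
    IsLimit A v P Q := by
  obtain ⟨s, hs, hsv⟩ := exists_cross_eq_smul (hc.cross_ne_zero hli) hv hx hx'
  obtain ⟨G, hG⟩ := exists_polynomial_cross A x y z x' y' z'
  have h0 : ∀ j, (G j).eval 0 = s * v j := fun j => by
    have := congrFun (hG 0) j
    simp only [curve, zero_smul, ne_eq, OfNat.ofNat_ne_zero, not_false_eq_true, zero_pow,
      add_zero, hsv] at this
    simpa using this
  refine ⟨k, s, fun j => Polynomial.C s⁻¹ * G j, hs, ?_, fun ε => ?_⟩
  · funext j
    simp [h0, hs]
  · rw [hfac, ← hG]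
    funext j
    simp
    field_simp

/-- A line that misses the center. -/
theorem isLimit_of_linearIndependent {A : Matrix (Fin 3) (Fin 4) ℂ} {c : V4}
    (hc : IsCenterVector A c) {v : Fin 3 → ℂ} (hv : v ≠ 0) {p q : V4} (hp : v ⬝ᵥ A *ᵥ p = 0)
    (hq : v ⬝ᵥ A *ᵥ q = 0) (hli : LinearIndependent ℂ ![c, p, q]) (p' p'' q' q'' : V4) :
    IsLimit A v (curve p p' p'') (curve q q' q'') :=
  isLimit_of_factor hc hv 0 (fun ε => by rw [pow_zero, one_smul]) hp hq hli

/-- A nonzero vector is the first row of a matrix of determinant one. -/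
theorem exists_det_eq_one {a b : ℂ} (h : a ≠ 0 ∨ b ≠ 0) : ∃ a' b' : ℂ, a * b' - b * a' = 1 := by
  rcases h with h | h
  · exact ⟨0, a⁻¹, by field_simp; ring⟩
  · exact ⟨-b⁻¹, 0, by field_simp; ring⟩

/-- A line through the center `a p + b q`: the first nonvanishing derivative `w` of the moving
point `a P + b Q` determines the limit plane as the span of the line and `w`. -/
theorem isLimit_of_mem_line {A : Matrix (Fin 3) (Fin 4) ℂ} {c : V4}
    (hc : IsCenterVector A c) {v : Fin 3 → ℂ} (hv : v ≠ 0) {p q : V4} (hp : v ⬝ᵥ A *ᵥ p = 0)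
    (hq : v ⬝ᵥ A *ᵥ q = 0) {a b : ℂ} (hcab : c = a • p + b • q) {p' p'' q' q'' w w' : V4} (k : ℕ)
    (hw : ∀ ε : ℂ, ε • (a • p' + b • q') + ε ^ 2 • (a • p'' + b • q'') = ε ^ k • (w + ε • w'))
    (hvw : v ⬝ᵥ A *ᵥ w = 0) (hli : LinearIndependent ℂ ![w, p, q]) :
    IsLimit A v (curve p p' p'') (curve q q' q'') := by
  have hab : a ≠ 0 ∨ b ≠ 0 := by
    by_contra! h
    exact hc.1 (by rw [hcab, h.1, h.2]; simp)
  -- a unimodular change of basis of the line makes its first basis point the center, whose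
  -- image is the multiple `ε ^ k` of a curve through `A w`
  obtain ⟨a', b', hdet⟩ := exists_det_eq_one hab
  refine isLimit_of_factor hc hv k (x := w) (y := w') (z := 0) (x' := a' • p + b' • q)
    (y' := a' • p' + b' • q') (z' := a' • p'' + b' • q'') (fun ε => ?_) hvw ?_ ?_
  · have h1 : A *ᵥ (a • curve p p' p'' ε + b • curve q q' q'' ε) =
        ε ^ k • (A *ᵥ curve w w' 0 ε) := by
      have : a • curve p p' p'' ε + b • curve q q' q'' ε = c + ε ^ k • curve w w' 0 ε := by
        have : curve w w' 0 ε = w + ε • w' := by simp [curve]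
        rw [this, ← hw, hcab]
        simp only [curve]
        module
      rw [this, Matrix.mulVec_add, hc.mulVec_eq_zero, zero_add, Matrix.mulVec_smul]
    have h2 : curve (a' • p + b' • q) (a' • p' + b' • q') (a' • p'' + b' • q'') ε =
        a' • curve p p' p'' ε + b' • curve q q' q'' ε := by
      simp only [curve]
      module
    rw [h2, ← LinearMap.smul_apply, ← map_smul, ← h1]
    simp only [Matrix.mulVec_add, Matrix.mulVec_smul, map_add, map_smul, LinearMap.add_apply,
      LinearMap.smul_apply, cross_self]
    rw [← cross_anticomm (A *ᵥ curve p p' p'' ε) (A *ᵥ curve q q' q'' ε)]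
    have : ∀ X : Fin 3 → ℂ, X = (a * b' - b * a') • X := fun X => by rw [hdet, one_smul]
    conv_lhs => rw [this ((A *ᵥ curve p p' p'' ε) ⨯₃ (A *ᵥ curve q q' q'' ε))]
    module
  · rw [Matrix.mulVec_add, Matrix.mulVec_smul, Matrix.mulVec_smul, dotProduct_add,
      dotProduct_smul, dotProduct_smul, hp, hq]
    simp
  · rw [Fintype.linearIndependent_iff] at hli ⊢
    intro g hg
    simp only [Fin.sum_univ_three, Matrix.cons_val] at hg
    have := hli ![g 1, g 0 * a + g 2 * a', g 0 * b + g 2 * b'] (by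
      simp only [Fin.sum_univ_three, Matrix.cons_val]
      rw [← hg, hcab]
      module)
    have e0 := this 0
    have e1 := this 1
    have e2 := this 2
    simp only [Matrix.cons_val] at e0 e1 e2
    intro i
    fin_cases i
    · change g 0 = 0
      linear_combination b' * e1 - a' * e2 - g 0 * hdet
    · exact e0
    · change g 2 = 0
      linear_combination a * e2 - b * e1 - g 2 * hdet

/-- If any four of the tensors of `(a i, b i)` and `h i` with `i ∈ S` are dependent, then there is a
nonzero linear map `p ↦ α₀ g₁ + α₁ g₂`, `q ↦ α₂ g₁ + α₃ g₂` that sends each point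
`a i p + b i q`, `i ∈ S`, into the plane `h i`. -/
theorem exists_first_order {a b : Fin m → ℂ} {h : Fin m → V4} {S : Fin m → Prop} (g₁ g₂ : V4)
    (hdep : ∀ σ : Fin 4 ↪o Fin m, (∀ k, S (σ k)) → ∃ μ : Fin 4 → ℂ, μ ≠ 0 ∧ ∀ z : V4,
      ∑ k, μ k * (a (σ k) * (h (σ k) ⬝ᵥ z)) = 0 ∧ ∑ k, μ k * (b (σ k) * (h (σ k) ⬝ᵥ z)) = 0) :
    ∃ α : Fin 4 → ℂ, α ≠ 0 ∧ ∀ i, S i →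
      h i ⬝ᵥ ((a i * α 0 + b i * α 2) • g₁ + (a i * α 1 + b i * α 3) • g₂) = 0 := by
  classical
  obtain ⟨α, hα, hx⟩ := exists_annihilator (n := 4) (fun i : Fin m => if S i then
    ![a i * (h i ⬝ᵥ g₁), a i * (h i ⬝ᵥ g₂), b i * (h i ⬝ᵥ g₁), b i * (h i ⬝ᵥ g₂)] else 0) (by
      intro σ hσ
      by_cases hS : ∀ k, S (σ k)
      · obtain ⟨μ, hμ, hz⟩ := hdep σ hS
        refine hμ (funext (Fintype.linearIndependent_iff.1 hσ μ ?_))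
        funext j
        simp only [Function.comp, hS, if_true, Finset.sum_apply, Pi.smul_apply, smul_eq_mul]
        fin_cases j
        · exact (hz g₁).1
        · exact (hz g₂).1
        · exact (hz g₁).2
        · exact (hz g₂).2
      · push Not at hS
        obtain ⟨k, hk⟩ := hS
        exact hσ.ne_zero k (by simp [hk]))
  refine ⟨α, hα, fun i hi => ?_⟩
  have := hx i
  rw [if_pos hi] at this
  simp [dotProduct, Fin.sum_univ_four] at this ⊢
  linear_combination this

theorem linearIndependent_cons_of_ne_zero {g₁ g₂ p q : V4}
    (hli : LinearIndependent ℂ ![g₁, g₂, p, q]) {x y : ℂ} (h : ¬ (x = 0 ∧ y = 0)) :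
    LinearIndependent ℂ ![x • g₁ + y • g₂, p, q] := by
  rw [Fintype.linearIndependent_iff] at hli ⊢
  intro g hg
  simp only [Fin.sum_univ_three, Matrix.cons_val] at hg
  have := hli ![g 0 * x, g 0 * y, g 1, g 2] (by
    simp only [Fin.sum_univ_four, Matrix.cons_val]
    rw [← hg]
    module)
  have e0 := this 0
  have e1 := this 1
  have e2 := this 2
  have e3 := this 3
  simp only [Matrix.cons_val, mul_eq_zero] at e0 e1 e2 e3
  have hg0 : g 0 = 0 := by tauto
  intro i
  fin_cases i
  · exact hg0
  · exact e2
  · exact e3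

/-- There is a deformation of the line `⟨p, q⟩` to second order under which the planes joining it
to the centers `a i p + b i q` on it converge to the planes `h i`. -/
theorem exists_deformation {a b : Fin m → ℂ} {h : Fin m → V4} {S : Fin m → Prop}
    {g₁ g₂ p q : V4} (hli : LinearIndependent ℂ ![g₁, g₂, p, q])
    (hab : ∀ i j, S i → S j → i ≠ j → a i * b j - a j * b i ≠ 0)
    (hab' : ∀ i, S i → a i ≠ 0 ∨ b i ≠ 0)
    (hne : ∀ i, h i ≠ 0) (hp : ∀ i, h i ⬝ᵥ p = 0) (hq : ∀ i, h i ⬝ᵥ q = 0)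
    (hdep : ∀ σ : Fin 4 ↪o Fin m, (∀ k, S (σ k)) → ∃ μ : Fin 4 → ℂ, μ ≠ 0 ∧ ∀ z : V4,
      ∑ k, μ k * (a (σ k) * (h (σ k) ⬝ᵥ z)) = 0 ∧ ∑ k, μ k * (b (σ k) * (h (σ k) ⬝ᵥ z)) = 0) :
    ∃ p' p'' q' q'' : V4, ∀ i, S i → ∃ (k : ℕ) (w w' : V4),
      (∀ ε : ℂ, ε • (a i • p' + b i • q') + ε ^ 2 • (a i • p'' + b i • q'') =
        ε ^ k • (w + ε • w')) ∧ h i ⬝ᵥ w = 0 ∧ LinearIndependent ℂ ![w, p, q] := by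
  obtain ⟨α, hα, hαh⟩ := exists_first_order g₁ g₂ hdep
  -- the points that are moved to first order
  have first : ∀ i, S i → ¬ (a i * α 0 + b i * α 2 = 0 ∧ a i * α 1 + b i * α 3 = 0) →
      ∀ p'' q'' : V4, ∃ (k : ℕ) (w w' : V4),
      (∀ ε : ℂ, ε • (a i • (α 0 • g₁ + α 1 • g₂) + b i • (α 2 • g₁ + α 3 • g₂)) +
        ε ^ 2 • (a i • p'' + b i • q'') = ε ^ k • (w + ε • w')) ∧ h i ⬝ᵥ w = 0 ∧
        LinearIndependent ℂ ![w, p, q] := fun i hi hi' p'' q'' =>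
    ⟨1, _, a i • p'' + b i • q'', fun ε => by module, hαh i hi,
      linearIndependent_cons_of_ne_zero hli hi'⟩
  by_cases hj : ∃ j, S j ∧ a j * α 0 + b j * α 2 = 0 ∧ a j * α 1 + b j * α 3 = 0
  · -- the first-order deformation has rank one and fixes exactly one center, which has to be moved
    -- to second order
    obtain ⟨j, hSj, h₁, h₂⟩ := hj
    obtain ⟨a', b', hdet⟩ := exists_det_eq_one (hab' j hSj)
    set w : V4 := (h j ⬝ᵥ g₂) • g₁ + (-(h j ⬝ᵥ g₁)) • g₂ with hw
    refine ⟨α 0 • g₁ + α 1 • g₂, b' • w, α 2 • g₁ + α 3 • g₂, -a' • w, fun i hi => ?_⟩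
    by_cases hij : i = j
    · subst hij
      refine ⟨2, w, 0, fun ε => ?_, ?_, linearIndependent_cons_of_ne_zero hli fun h0 => ?_⟩
      · have e1 : a i • (α 0 • g₁ + α 1 • g₂) + b i • (α 2 • g₁ + α 3 • g₂) =
            (a i * α 0 + b i * α 2) • g₁ + (a i * α 1 + b i * α 3) • g₂ := by module
        have e2 : a i • b' • w + b i • -a' • w = (a i * b' - b i * a') • w := by module
        rw [e1, e2, h₁, h₂, hdet]
        simp
      · rw [hw]
        simp [dotProduct_add, dotProduct_smul]
        ring
      · apply hne i
        rw [← dotProduct_eq_zero_iff]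
        intro z
        obtain ⟨s, rfl⟩ := exists_coords hli z
        simp [dotProduct_add, hp, hq, h0.1, neg_eq_zero.1 h0.2]
    · refine first i hi (fun h0 => hα ?_) _ _
      have hD := hab i j hi hSj hij
      have e0 : α 0 = 0 := (mul_eq_zero.1 (show (a i * b j - a j * b i) * α 0 = 0 by
        linear_combination b j * h0.1 - b i * h₁)).resolve_left hD
      have e1 : α 1 = 0 := (mul_eq_zero.1 (show (a i * b j - a j * b i) * α 1 = 0 by
        linear_combination b j * h0.2 - b i * h₂)).resolve_left hD
      have e2 : α 2 = 0 := (mul_eq_zero.1 (show (a i * b j - a j * b i) * α 2 = 0 by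
        linear_combination a i * h₁ - a j * h0.1)).resolve_left hD
      have e3 : α 3 = 0 := (mul_eq_zero.1 (show (a i * b j - a j * b i) * α 3 = 0 by
        linear_combination a i * h₂ - a j * h0.2)).resolve_left hD
      funext k
      fin_cases k <;> assumption
  · push Not at hj
    exact ⟨_, 0, _, 0, fun i hi => first i hi (fun h0 => hj i hi h0.1 h0.2) 0 0⟩

/-! ### Limits lie in the Zariski closure -/

theorem mk_mem_jointImage [Nonempty (Fin m)] {g : Fin m → Fin 3 → ℂ} (hg : ∀ i, g i ≠ 0)
    {t : Fin m → ℂ} (ht : ∀ i, t i ≠ 0) {p q : V4}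
    (h : ∀ i, (C i *ᵥ p) ⨯₃ (C i *ᵥ q) = t i • g i) :
    (fun i => Projectivization.mk ℂ (g i) (hg i)) ∈ jointImage C := by
  have hcross : ∀ i, (C i *ᵥ p) ⨯₃ (C i *ᵥ q) ≠ 0 := fun i => by
    rw [h]
    exact smul_ne_zero (ht i) (hg i)
  have hli : LinearIndependent ℂ ![p, q] := by
    obtain ⟨i⟩ := ‹Nonempty (Fin m)›
    have := crossProduct_ne_zero_iff_linearIndependent.1 (hcross i)
    rw [LinearIndependent.pair_iff] at this ⊢
    intro x y hxy
    refine this x y ?_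
    rw [← Matrix.mulVec_smul, ← Matrix.mulVec_smul, ← Matrix.mulVec_add, hxy, Matrix.mulVec_zero]
  refine ⟨_, ?_, p, q, rfl, fun i => ⟨hcross i, ?_⟩⟩
  · have := finrank_span_eq_card hli
    rwa [Matrix.range_cons_cons_empty, Fintype.card_fin] at this
  · rw [Projectivization.mk_eq_mk_iff']
    refine ⟨(t i)⁻¹, ?_⟩
    rw [h, smul_smul, inv_mul_cancel₀ (ht i), one_smul]

theorem evalAt_eq_zero_of_cross [Nonempty (Fin m)] {g : Fin m → Fin 3 → ℂ} (hg : ∀ i, g i ≠ 0)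
    {t : Fin m → ℂ} (ht : ∀ i, t i ≠ 0) {p q : V4}
    (h : ∀ i, (C i *ᵥ p) ⨯₃ (C i *ᵥ q) = t i • g i) {F : R m}
    (hF : ∀ l ∈ jointImage C, VanishesAt F l) : evalAt g F = 0 :=
  hF _ (mk_mem_jointImage hg ht h) g hg fun _ => rfl

/-- If all `v i` are limits along one moving line, then every polynomial vanishing on the image of
the joint camera map vanishes at `v`. -/
theorem evalAt_eq_zero_of_isLimit [Nonempty (Fin m)] {v : Fin m → Fin 3 → ℂ} (hv : ∀ i, v i ≠ 0)
    {P Q : ℂ → V4} (hlim : ∀ i, IsLimit (C i) (v i) P Q) {F : R m}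
    (hF : ∀ l ∈ jointImage C, VanishesAt F l) : evalAt v F = 0 := by
  choose k s G hs hG0 hG using hlim
  have hcoord : ∀ i, ∃ j, v i j ≠ 0 := fun i => Function.ne_iff.1 (hv i)
  choose j hj using hcoord
  set H : Polynomial ℂ := MvPolynomial.aeval (fun t : Fin m × Fin 3 => G t.1 t.2) F
  have hH : ∀ ε, H.eval ε = evalAt (fun i j => (G i j).eval ε) F := fun ε => by
    rw [evalAt, ← Polynomial.coe_evalRingHom]
    simp only [H, MvPolynomial.aeval_def, MvPolynomial.eval, MvPolynomial.hom_eval₂]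
    congr 1
    ext
    simp
  -- where `N` does not vanish, the moving line misses all centers
  set N : Polynomial ℂ := Polynomial.X * ∏ i, G i (j i)
  have hN : N ≠ 0 := by
    refine mul_ne_zero Polynomial.X_ne_zero (Finset.prod_ne_zero_iff.2 fun i _ h0 => hj i ?_)
    rw [← hG0 i]
    simp only [h0, Polynomial.eval_zero]
  have hNH : N * H = 0 := by
    refine Polynomial.funext fun ε => ?_
    rw [Polynomial.eval_mul, Polynomial.eval_zero, mul_eq_zero]
    by_cases hNε : N.eval ε = 0
    · exact Or.inl hNε
    right
    rw [Polynomial.eval_mul, Polynomial.eval_X, Polynomial.eval_prod, ← ne_eq, mul_ne_zero_iff,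
      Finset.prod_ne_zero_iff] at hNε
    have hGε : ∀ i, (fun j => (G i j).eval ε) ≠ 0 := fun i h0 =>
      hNε.2 i (Finset.mem_univ i) (congrFun h0 (j i))
    have hsε : ∀ i, s i * ε ^ k i ≠ 0 := fun i => mul_ne_zero (hs i) (pow_ne_zero _ hNε.1)
    rw [hH]
    exact evalAt_eq_zero_of_cross hGε hsε (fun i => hG i ε) hF
  have h0 := hH 0
  rw [(mul_eq_zero.1 hNH).resolve_left hN, Polynomial.eval_zero] at h0
  rw [show (fun i j => (G i j).eval 0) = v from funext hG0] at h0
  exact h0.symm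

theorem zeroLocus_subset_lineMultiviewVariety (hrank : ∀ i, (C i).rank = 3)
    (hdistinct : ∀ i j, i ≠ j → center (C i) ≠ center (C j))
    {c : Fin m → V4} (hc : ∀ i, IsCenterVector (C i) (c i)) {f : (Fin 4 ↪o Fin m) → Fin 3 → V4}
    (hf : ∀ σ, IsCollinear C σ → IsDualTriple (baseline C σ) (f σ)) :
    zeroLocus (extendedIdeal C c f : Set (R m)) ⊆ lineMultiviewVariety C := by
  rintro l hl _ ⟨⟨T, -, rfl⟩, hT⟩ F hFT v hv hvl
  have hF : ∀ l ∈ jointImage C, VanishesAt F l := fun l hl => hT hl F hFT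
  rw [mem_zeroLocus_extendedIdeal] at hl
  obtain ⟨hmin, hPhi⟩ := hl v hv hvl
  obtain ⟨p, q, hpq, horth⟩ := (forall_minors_iff v).1 hmin
  have hspan := finrank_span_eq_card hpq
  rw [Matrix.range_cons_cons_empty, Fintype.card_fin] at hspan
  rcases isEmpty_or_nonempty (Fin m) with hm | hm
  · -- without cameras every tuple is in the image
    exact hF l ⟨_, hspan, p, q, rfl, fun i => hm.elim i⟩ v hv hvl
  obtain ⟨g₁, g₂, hli⟩ := exists_basis_extension hpq
  have hcases : ∀ i, ∃ a b : ℂ, (∃ a b : ℂ, c i = a • p + b • q) → c i = a • p + b • q :=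
    fun i => by
      by_cases h : ∃ a b : ℂ, c i = a • p + b • q
      · obtain ⟨a, b, hab⟩ := h
        exact ⟨a, b, fun _ => hab⟩
      · exact ⟨0, 0, fun h' => absurd h' h⟩
  -- `(a i, b i)` are the coordinates of the centers on the line `⟨p, q⟩`, junk for the others
  choose a b hab using hcases
  set S : Fin m → Prop := fun i => ∃ a b : ℂ, c i = a • p + b • q
  have hcli : ∀ i j, i ≠ j → LinearIndependent ℂ ![c i, c j] := fun i j hij =>
    linearIndependent_centers (hc i) (hc j) (hdistinct i j hij)
  have hcombo : ∀ {x y x' y' : ℂ}, x • p + y • q = x' • p + y' • q → x = x' ∧ y = y' := by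
    intro x y x' y' h
    have := LinearIndependent.pair_iff.1 hpq (x - x') (y - y') (by
      rw [← sub_eq_zero] at h; rw [← h]; module)
    exact ⟨sub_eq_zero.1 this.1, sub_eq_zero.1 this.2⟩
  obtain ⟨p', p'', q', q'', hdef⟩ := exists_deformation (a := a) (b := b)
    (h := fun i => (C i)ᵀ *ᵥ v i) (S := S) hli
    (by
      intro i j hi hj hij h0
      have h1 := LinearIndependent.pair_iff.1 (hcli i j hij) (b j) (-b i) (by
        rw [hab i hi, hab j hj]
        have : b j • (a i • p + b i • q) + -b i • (a j • p + b j • q) =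
          (a i * b j - a j * b i) • p := by module
        rw [this, h0, zero_smul])
      have h2 := LinearIndependent.pair_iff.1 (hcli i j hij) (a j) (-a i) (by
        rw [hab i hi, hab j hj]
        have : a j • (a i • p + b i • q) + -a i • (a j • p + b j • q) =
          -(a i * b j - a j * b i) • q := by module
        rw [this, h0, neg_zero, zero_smul])
      exact (hc j).1 (by rw [hab j hj, h1.1, h2.1]; simp))
    (by
      intro i hi
      by_contra! h
      exact (hc i).1 (by rw [hab i hi, h.1, h.2]; simp))
    (by
      intro i h0
      refine hv i (eq_zero_of_forall_dotProduct_mulVec (hrank i) fun z => ?_)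
      rw [← transpose_mulVec_dotProduct, h0, zero_dotProduct])
    (fun i => by rw [transpose_mulVec_dotProduct, (horth i).1])
    (fun i => by rw [transpose_mulVec_dotProduct, (horth i).2])
    (by
      intro σ hS
      -- four centers on the line `⟨p, q⟩`, which is thus their baseline
      have hσ : IsCollinear C σ := by
        refine ⟨_, hspan, fun k => ?_⟩
        rw [← (hc (σ k)).2, Submodule.span_singleton_le_iff_mem, Submodule.mem_span_pair]
        exact ⟨_, _, (hab _ (hS k)).symm⟩
      obtain ⟨a₀, b₀, hab₀, hli₀, hD⟩ := exists_det_Phi_eq_zero_iff hdistinct hc hσ (hf σ hσ)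
      have hdet := (hD v).1 (hPhi σ hσ)
      simp only [← transpose_mulVec_dotProduct] at hdet
      have hzero : ∀ k l, ((C (σ k))ᵀ *ᵥ v (σ k)) ⬝ᵥ c (σ l) = 0 := fun k l => by
        rw [hab _ (hS l), dotProduct_add, dotProduct_smul, dotProduct_smul,
          transpose_mulVec_dotProduct, transpose_mulVec_dotProduct, (horth _).1, (horth _).2]
        simp
      obtain ⟨μ, hμ, hrel⟩ := exists_tensor_relation (h := fun k => (C (σ k))ᵀ *ᵥ v (σ k))
        hli₀ (fun k => hzero k 0) (fun k => hzero k 1) hdet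
      have hlin : ∀ k, a (σ k) = a₀ k * a (σ 0) + b₀ k * a (σ 1) ∧
          b (σ k) = a₀ k * b (σ 0) + b₀ k * b (σ 1) := fun k => by
        refine hcombo ?_
        rw [← hab _ (hS k), hab₀, hab _ (hS 0), hab _ (hS 1)]
        module
      refine ⟨μ, hμ, fun z => ⟨?_, ?_⟩⟩
      · rw [← hrel (a (σ 0)) (a (σ 1)) z]
        exact Finset.sum_congr rfl fun k _ => by rw [← (hlin k).1]
      · rw [← hrel (b (σ 0)) (b (σ 1)) z]
        exact Finset.sum_congr rfl fun k _ => by rw [← (hlin k).2])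
  refine evalAt_eq_zero_of_isLimit hv (P := curve p p' p'') (Q := curve q q' q'') (fun i => ?_) hF
  by_cases hi : S i
  · obtain ⟨k, w, w', hw, hhw, hwli⟩ := hdef i hi
    rw [transpose_mulVec_dotProduct] at hhw
    exact isLimit_of_mem_line (hc i) (hv i) (horth i).1 (horth i).2 (hab i hi) k hw hhw hwli
  · refine isLimit_of_linearIndependent (hc i) (hv i) (horth i).1 (horth i).2 ?_ _ _ _ _
    refine linearIndependent_finCons.2 ⟨hpq, fun hmem => hi ?_⟩
    rw [Matrix.range_cons_cons_empty, Submodule.mem_span_pair] at hmem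
    obtain ⟨x, y, hxy⟩ := hmem
    exact ⟨x, y, hxy.symm⟩

end LineMultiview

end

theorem corollary5p7 (m : ℕ) (C : Fin m → Matrix (Fin 3) (Fin 4) ℂ)
    (hrank : ∀ i, (C i).rank = 3)
    (hdistinct : ∀ i j, i ≠ j → LineMultiview.center (C i) ≠ LineMultiview.center (C j))
    (c : Fin m → Fin 4 → ℂ) (hc : ∀ i, LineMultiview.IsCenterVector (C i) (c i))
    (f : (Fin 4 ↪o Fin m) → Fin 3 → Fin 4 → ℂ)
    (hf : ∀ σ, LineMultiview.IsCollinear C σ →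
      LineMultiview.IsDualTriple (LineMultiview.baseline C σ) (f σ)) :
    LineMultiview.lineMultiviewVariety C =
      LineMultiview.zeroLocus (LineMultiview.extendedIdeal C c f : Set (LineMultiview.R m)) := by
  refine Set.Subset.antisymm (Set.sInter_subset_of_mem ⟨?_, ?_⟩) ?_
  · exact LineMultiview.isZariskiClosed_zeroLocus hdistinct hc hf
  · exact LineMultiview.jointImage_subset_zeroLocus hdistinct hc hf
  · exact LineMultiview.zeroLocus_subset_lineMultiviewVariety hrank hdistinct hc hf
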